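/- Let $F$ be an algebraically closed field of characteristic $p>3$, let $\Gamma$ be an abelian group, and let $(\,,):\Gamma\times\Gamma\to F^{\times}$ be a bicharacter, i.e. $(\alpha,\beta)(\beta,\alpha)=1$, $(\alpha,\beta+\gamma)=(\alpha,\beta)(\alpha,\gamma)$ and $(\alpha+\beta,\gamma)=(\alpha,\gamma)(\beta,\gamma)$. Then $(\alpha,\alpha)=\pm1$; call $\alpha$ even if $(\alpha,\alpha)=1$ and odd otherwise. A Lie color algebra is a $\Gamma$-graded $F$-space $\mathfrak g=\bigoplus_{\alpha}\mathfrak g_\alpha$ with a bilinear bracket such that $[\mathfrak g_\alpha,\mathfrak g_\beta]\subseteq\mathfrak g_{\alpha+\beta}$ and, for $x\in\mathfrak g_\alpha$, $y\in\mathfrak g_\beta$, $z\in\mathfrak g_\gamma$, $$[y,x]=-(\beta,\alpha)[x,y],\qquad (\gamma,\alpha)[x,[y,z]]+(\alpha,\beta)[y,[z,x]]+(\beta,\gamma)[z,[x,y]]=0 .$$ It is restricted if for each even $\gamma$ there is a map $x\mapsto x^{[p]}$ from $\mathfrak g_\gamma$ to $\mathfrak g_{p\gamma}$ such that, for $x,y\in\mathfrak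 g_\gamma$ and $r\in F$, $(rx)^{[p]}=r^px^{[p]}$, $\operatorname{ad}x^{[p]}=(\operatorname{ad}x)^p$, and $(x+y)^{[p]}=x^{[p]}+y^{[p]}+\sum_{i=1}^{p-1}s_i(x,y)$, where $i\,s_i(x,y)$ is the coefficient of $t^{i-1}$ in $(\operatorname{ad}(tx+y))^{p-1}(x)\in\mathfrak g[t]$. It is unipotent if for every even $\alpha$ and every $x\in\mathfrak g_\alpha$ there is $n>0$ with $x^{[p]^n}=0$. The restricted enveloping algebra $u(\mathfrak g)$ is the quotient of the tensor algebra $T(\mathfrak g)$ by the two-sided ideal generated by $x\otimes y-(\alpha,\beta)\,y\otimes x-[x,y]$ ($x\in\mathfrak g_\alpha$, $y\in\mathfrak g_\beta$) and $x^{p}-x^{[p]}$ ($x\in\mathfrak g_\alpha$, $\alpha$ even), with the induced $\Gamma$-grading. A bilinear form $f$ on $u(\mathfrak g)$ is invariant if $f(xy,z)=f(x,yz)$ for all $x,y,z$, and color-symmetric if $f(x,y)=(\alpha,\beta)f(y,x)$ whenever $x\in u(\mathfrak g)_\alpha$ and $y\in u(\mathfrak g)_\beta$. Lemma 2.19. Let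 $\mathfrak g$ be a finite-dimensional unipotent restricted Lie color algebra. Then $u(\mathfrak g)$ is a symmetric algebra, i.e. it has a nondegenerate, invariant, color-symmetric bilinear form. More precisely, let $e_1,\dots,e_n$ be any homogeneous basis of $\mathfrak g$ in which the elements of even degree precede those of odd degree, and let $\tau(i)=p-1$ if $e_i$ has even degree and $\tau(i)=1$ if it has odd degree. Then the monomials $e^a=e_1^{a_1}\cdots e_n^{a_n}$ with $0\le a_i\le\tau(i)$ form a basis of $u(\mathfrak g)$, and the Frobenius form $$\bar\mu(x,y)=\text{the coefficient of }e^\tau\text{ in the expansion of }xy\text{ in this basis}$$ is nondegenerate, invariant and color-symmetric. -/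

import Mathlib

/-- A (skew-symmetric) bicharacter `Γ × Γ → Fˣ` on an abelian group `Γ`. -/
structure Bicharacter (F : Type*) [Field F] (Γ : Type*) [AddCommGroup Γ] where
  toFun : Γ → Γ → Fˣ
  mul_swap : ∀ α β, toFun α β * toFun β α = 1
  add_right : ∀ α β γ, toFun α (β + γ) = toFun α β * toFun α γ
  add_left : ∀ α β γ, toFun (α + β) γ = toFun α γ * toFun β γ

/-- A degree `α` is even (it lies in `Γ⁺`) if `(α, α) = 1`; otherwise `(α, α) = -1` and it is
odd. -/
def Bicharacter.Even {F : Type*} [Field F] {Γ : Type*} [AddCommGroup Γ]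
    (χ : Bicharacter F Γ) (α : Γ) : Prop :=
  χ.toFun α α = 1

/-- A Lie color algebra structure on the `F`-vector space `L`, for the group `Γ` with
bicharacter `χ`. -/
structure LieColorAlgebra {F : Type*} [Field F] {Γ : Type*} [AddCommGroup Γ] [DecidableEq Γ]
    (χ : Bicharacter F Γ) (L : Type*) [AddCommGroup L] [Module F L] where
  /-- the homogeneous components -/
  comp : Γ → Submodule F L
  isInternal : DirectSum.IsInternal comp
  /-- the bracket -/
  br : L →ₗ[F] L →ₗ[F] L
  br_mem : ∀ {α β : Γ} {x y : L}, x ∈ comp α → y ∈ comp β → br x y ∈ comp (α + β)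
  skew : ∀ {α β : Γ} {x y : L}, x ∈ comp α → y ∈ comp β →
    br y x = -((χ.toFun β α : F) • br x y)
  jacobi : ∀ {α β γ : Γ} {x y z : L}, x ∈ comp α → y ∈ comp β → z ∈ comp γ →
    (χ.toFun γ α : F) • br x (br y z) + (χ.toFun α β : F) • br y (br z x)
      + (χ.toFun β γ : F) • br z (br x y) = 0

/-- `g.adCoeff x y m j` is the coefficient of `t ^ j` in `(ad (t x + y)) ^ m (x) ∈ L[t]`. -/
def LieColorAlgebra.adCoeff {F : Type*} [Field F] {Γ : Type*} [AddCommGroup Γ] [DecidableEq Γ]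
    {χ : Bicharacter F Γ} {L : Type*} [AddCommGroup L] [Module F L]
    (g : LieColorAlgebra χ L) (x y : L) : ℕ → ℕ → L
  | 0, 0 => x
  | 0, _ + 1 => 0
  | m + 1, 0 => g.br y (g.adCoeff x y m 0)
  | m + 1, j + 1 => g.br x (g.adCoeff x y m j) + g.br y (g.adCoeff x y m (j + 1))

/-- A restricted Lie color algebra. The `p`-map is only meaningful on homogeneous elements of even
degree: it is a total function here, on which nothing is imposed (and whose values are never
used) elsewhere. -/
structure RestrictedLieColorAlgebra {F : Type*} [Field F] (p : ℕ) {Γ : Type*} [AddCommGroup Γ]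
    [DecidableEq Γ] (χ : Bicharacter F Γ) (L : Type*) [AddCommGroup L] [Module F L]
    extends LieColorAlgebra χ L where
  /-- the `p`-map `x ↦ x^[p]` -/
  pmap : L → L
  pmap_mem : ∀ {γ : Γ} {x : L}, χ.Even γ → x ∈ comp γ → pmap x ∈ comp (p • γ)
  pmap_add : ∀ {γ : Γ} {x y : L}, χ.Even γ → x ∈ comp γ → y ∈ comp γ →
    pmap (x + y) = pmap x + pmap y +
      ∑ i ∈ Finset.Icc 1 (p - 1), (i : F)⁻¹ • toLieColorAlgebra.adCoeff x y (p - 1) (i - 1)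
  pmap_smul : ∀ {γ : Γ} {x : L} (r : F), χ.Even γ → x ∈ comp γ → pmap (r • x) = r ^ p • pmap x
  br_pmap : ∀ {γ : Γ} {x : L}, χ.Even γ → x ∈ comp γ → ∀ y : L, br (pmap x) y = (br x)^[p] y

/-- A bilinear form on a graded space is color-symmetric if `f(x, y) = (α, β) f(y, x)` for `x`, `y`
homogeneous of degrees `α`, `β`. -/
def IsColorSymmetric {F : Type*} [Field F] {Γ : Type*} [AddCommGroup Γ]
    (χ : Bicharacter F Γ) {A : Type*} [AddCommGroup A] [Module F A] (𝒜 : Γ → Submodule F A)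
    (f : LinearMap.BilinForm F A) : Prop :=
  ∀ (α β : Γ) (x y : A), x ∈ 𝒜 α → y ∈ 𝒜 β → f x y = (χ.toFun α β : F) * f y x

/-- A Frobenius form on an associative algebra: a nondegenerate invariant bilinear form. -/
structure IsFrobeniusForm {F : Type*} [Field F] {A : Type*} [Ring A] [Algebra F A]
    (f : LinearMap.BilinForm F A) : Prop where
  invariant : ∀ x y z : A, f (x * y) z = f x (y * z)
  nondegenerate : f.Nondegenerate

/-- A `Γ`-graded associative algebra is a (color) symmetric algebra if it has a color-symmetric
Frobenius form. -/
def IsColorSymmetricAlgebra {F : Type*} [Field F] {Γ : Type*} [AddCommGroup Γ] [DecidableEq Γ]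
    (χ : Bicharacter F Γ) {A : Type*} [Ring A] [Algebra F A] (𝒜 : Γ → Submodule F A)
    [GradedAlgebra 𝒜] : Prop :=
  ∃ f : LinearMap.BilinForm F A, IsFrobeniusForm f ∧ IsColorSymmetric χ 𝒜 f

/-- The form `(x, y) ↦ φ (x y)` on an algebra, for a linear functional `φ`. -/
noncomputable def mulForm {F : Type*} [Field F] {A : Type*} [Ring A] [Algebra F A] (φ : A →ₗ[F] F) :
    LinearMap.BilinForm F A :=
  (LinearMap.mul F A).compr₂ φ

namespace RestrictedLieColorAlgebra

section

variable {F : Type*} [Field F] {p : ℕ} {Γ : Type*} [AddCommGroup Γ] [DecidableEq Γ]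
  {χ : Bicharacter F Γ} {L : Type*} [AddCommGroup L] [Module F L]

/-- `g` is unipotent if every homogeneous `x` of even degree satisfies `x^([p]^n) = 0` for some
`n > 0`. -/
def IsUnipotent (g : RestrictedLieColorAlgebra p χ L) : Prop :=
  ∀ (α : Γ) (x : L), χ.Even α → x ∈ g.comp α → ∃ n : ℕ, 0 < n ∧ g.pmap^[n] x = 0

/-- The relations of the restricted enveloping algebra inside the tensor algebra. -/
inductive Rel (g : RestrictedLieColorAlgebra p χ L) :
    TensorAlgebra F L → TensorAlgebra F L → Prop
  | br {α β : Γ} {x y : L} (hx : x ∈ g.comp α) (hy : y ∈ g.comp β) :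
      Rel g (TensorAlgebra.ι F x * TensorAlgebra.ι F y
          - (χ.toFun α β : F) • (TensorAlgebra.ι F y * TensorAlgebra.ι F x))
        (TensorAlgebra.ι F (g.br x y))
  | pow {α : Γ} {x : L} (hα : χ.Even α) (hx : x ∈ g.comp α) :
      Rel g (TensorAlgebra.ι F x ^ p) (TensorAlgebra.ι F (g.pmap x))

/-- The restricted enveloping algebra `u(g)`: the quotient of the tensor algebra by the two-sided
ideal generated by `x ⊗ y - (α, β) y ⊗ x - [x, y]` (`x`, `y` homogeneous of degrees `α`, `β`) and
`x ^ p - x^[p]` (`x` homogeneous of even degree). -/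
def RestrictedEnveloping (g : RestrictedLieColorAlgebra p χ L) : Type _ :=
  RingQuot g.Rel

noncomputable instance (g : RestrictedLieColorAlgebra p χ L) : Ring g.RestrictedEnveloping :=
  inferInstanceAs (Ring (RingQuot g.Rel))

noncomputable instance (g : RestrictedLieColorAlgebra p χ L) : Algebra F g.RestrictedEnveloping :=
  inferInstanceAs (Algebra F (RingQuot g.Rel))

/-- The quotient map `T(g) → u(g)`. -/
noncomputable def umk (g : RestrictedLieColorAlgebra p χ L) :
    TensorAlgebra F L →ₐ[F] g.RestrictedEnveloping :=
  RingQuot.mkAlgHom F g.Rel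

/-- The canonical map `g → u(g)`. -/
noncomputable def uι (g : RestrictedLieColorAlgebra p χ L) : L →ₗ[F] g.RestrictedEnveloping :=
  g.umk.toLinearMap ∘ₗ TensorAlgebra.ι F

/-- The `Γ`-grading of `u(g)`: the component of degree `α` is spanned by the products
`x₁ ⋯ x_k` of homogeneous elements of `g` whose degrees add up to `α`. -/
noncomputable def uGrading (g : RestrictedLieColorAlgebra p χ L) (α : Γ) :
    Submodule F g.RestrictedEnveloping :=
  Submodule.span F {z | ∃ l : List (Γ × L), (∀ q ∈ l, q.2 ∈ g.comp q.1) ∧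
    (l.map Prod.fst).sum = α ∧ (l.map fun q => g.uι q.2).prod = z}

/-- The largest exponents `τ(i)` of the basis monomials: `p - 1` in even degree, and `1` in odd
degree. -/
noncomputable def tau (p : ℕ) (χ : Bicharacter F Γ) {n : ℕ} (d : Fin n → Γ) (i : Fin n) : ℕ :=
  open Classical in if χ.Even (d i) then p - 1 else 1

/-- The ordered monomial `e₁ ^ a₁ ⋯ eₙ ^ aₙ` in `u(g)`. -/
noncomputable def monomial (g : RestrictedLieColorAlgebra p χ L) {n : ℕ} (e : Fin n → L)
    (a : Fin n → ℕ) : g.RestrictedEnveloping :=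
  (List.ofFn fun i => g.uι (e i) ^ a i).prod

theorem uι_mem (g : RestrictedLieColorAlgebra p χ L) {α : Γ} {x : L} (hx : x ∈ g.comp α) :
    g.uι x ∈ g.uGrading α :=
  Submodule.subset_span ⟨[(α, x)], by simpa using hx, by simp, by simp⟩

theorem uι_mul (g : RestrictedLieColorAlgebra p χ L) {α β : Γ} {x y : L} (hx : x ∈ g.comp α)
    (hy : y ∈ g.comp β) :
    g.uι x * g.uι y - (χ.toFun α β : F) • (g.uι y * g.uι x) = g.uι (g.br x y) := by
  have h : g.umk _ = g.umk _ := RingQuot.mkAlgHom_rel F (Rel.br (g := g) hx hy)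
  rw [map_sub, map_smul, map_mul, map_mul] at h
  exact h

theorem uι_pow (g : RestrictedLieColorAlgebra p χ L) {α : Γ} {x : L} (hα : χ.Even α)
    (hx : x ∈ g.comp α) : g.uι x ^ p = g.uι (g.pmap x) := by
  have h : g.umk _ = g.umk _ := RingQuot.mkAlgHom_rel F (Rel.pow (g := g) hα hx)
  rw [map_pow] at h
  exact h

instance uGrading_gradedMonoid (g : RestrictedLieColorAlgebra p χ L) :
    SetLike.GradedMonoid g.uGrading where
  one_mem := Submodule.subset_span ⟨[], by simp, by simp, by simp⟩
  mul_mem := by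
    intro α β x y hx hy
    have h : g.uGrading α * g.uGrading β ≤ g.uGrading (α + β) := by
      unfold uGrading
      rw [Submodule.span_mul_span]
      refine Submodule.span_mono ?_
      rintro _ ⟨_, ⟨l, hl, rfl, rfl⟩, _, ⟨m, hm, rfl, rfl⟩, rfl⟩
      refine ⟨l ++ m, ?_, by simp, by simp⟩
      intro q hq
      rcases List.mem_append.1 hq with h | h
      exacts [hl q h, hm q h]
    exact h (Submodule.mul_mem_mul hx hy)

/-- The linear map `g → ⨁ u(g)_α` sending a homogeneous `x` to itself, placed in its degree. -/
noncomputable def uDecompLin (g : RestrictedLieColorAlgebra p χ L) :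
    L →ₗ[F] DirectSum Γ fun α => g.uGrading α :=
  letI := g.isInternal.chooseDecomposition
  (DirectSum.toModule F Γ _ fun α =>
    (DirectSum.lof F Γ (fun α => g.uGrading α) α) ∘ₗ
      ((g.uι.domRestrict (g.comp α)).codRestrict (g.uGrading α) fun x => g.uι_mem x.2)) ∘ₗ
  (DirectSum.decomposeLinearEquiv g.comp).toLinearMap

theorem uDecompLin_of_mem (g : RestrictedLieColorAlgebra p χ L) {α : Γ} {x : L}
    (hx : x ∈ g.comp α) :
    g.uDecompLin x = DirectSum.of (fun α => g.uGrading α) α ⟨g.uι x, g.uι_mem hx⟩ := by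
  let _ := g.isInternal.chooseDecomposition
  simp only [uDecompLin, LinearMap.comp_apply, LinearEquiv.coe_coe,
    DirectSum.decomposeLinearEquiv_apply, DirectSum.decompose_of_mem _ hx]
  rw [← DirectSum.lof_eq_of F, DirectSum.toModule_lof]
  rfl

theorem uDecompLin_rel (g : RestrictedLieColorAlgebra p χ L) {a b : TensorAlgebra F L}
    (h : g.Rel a b) :
    TensorAlgebra.lift F g.uDecompLin a = TensorAlgebra.lift F g.uDecompLin b := by
  induction h with
  | @br α β x y hx hy =>
    have key : ∀ (γ δ : Γ) (_ : γ = δ) (u : g.uGrading γ) (v : g.uGrading δ),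
        (u : g.RestrictedEnveloping) = v →
        DirectSum.of (fun α => g.uGrading α) γ u = DirectSum.of (fun α => g.uGrading α) δ v := by
      rintro γ _ rfl u v h
      rw [Subtype.ext h]
    have hyx : g.uι y * g.uι x ∈ g.uGrading (α + β) :=
      add_comm β α ▸ SetLike.mul_mem_graded (g.uι_mem hy) (g.uι_mem hx)
    have h1 : g.uDecompLin x * g.uDecompLin y = DirectSum.lof F Γ (fun α => g.uGrading α) (α + β)
        ⟨g.uι x * g.uι y, SetLike.mul_mem_graded (g.uι_mem hx) (g.uι_mem hy)⟩ := by
      rw [g.uDecompLin_of_mem hx, g.uDecompLin_of_mem hy, DirectSum.of_mul_of]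
      rfl
    have h2 : g.uDecompLin y * g.uDecompLin x = DirectSum.lof F Γ (fun α => g.uGrading α) (α + β)
        ⟨g.uι y * g.uι x, hyx⟩ := by
      rw [g.uDecompLin_of_mem hx, g.uDecompLin_of_mem hy, DirectSum.of_mul_of]
      exact key _ _ (add_comm _ _) _ _ rfl
    have h3 : g.uDecompLin (g.br x y) = DirectSum.lof F Γ (fun α => g.uGrading α) (α + β)
        ⟨g.uι (g.br x y), g.uι_mem (g.br_mem hx hy)⟩ := g.uDecompLin_of_mem (g.br_mem hx hy)
    rw [map_sub, map_smul, map_mul, map_mul, TensorAlgebra.lift_ι_apply,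
      TensorAlgebra.lift_ι_apply, TensorAlgebra.lift_ι_apply, h1, h2, h3, ← map_smul, ← map_sub]
    congr 1
    exact Subtype.ext (g.uι_mul hx hy)
  | @pow α x hα hx =>
    rw [map_pow, TensorAlgebra.lift_ι_apply, TensorAlgebra.lift_ι_apply, g.uDecompLin_of_mem hx,
      g.uDecompLin_of_mem (g.pmap_mem hα hx), DirectSum.ofPow]
    refine congrArg (DirectSum.of (fun α => g.uGrading α) (p • α)) ?_
    exact Subtype.ext (g.uι_pow hα hx)

/-- The algebra map `u(g) → ⨁ u(g)_α` splitting elements into homogeneous components. -/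
noncomputable def uDecomp (g : RestrictedLieColorAlgebra p χ L) :
    g.RestrictedEnveloping →ₐ[F] DirectSum Γ fun α => g.uGrading α :=
  RingQuot.liftAlgHom F ⟨TensorAlgebra.lift F g.uDecompLin, fun _ _ h => g.uDecompLin_rel h⟩

theorem uDecomp_uι (g : RestrictedLieColorAlgebra p χ L) (x : L) :
    g.uDecomp (g.uι x) = g.uDecompLin x := by
  exact (RingQuot.liftAlgHom_mkAlgHom_apply F _ _ _).trans (TensorAlgebra.lift_ι_apply _ _)

theorem uDecomp_prod (g : RestrictedLieColorAlgebra p χ L) (l : List (Γ × L))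
    (hl : ∀ q ∈ l, q.2 ∈ g.comp q.1)
    (h : (l.map fun q => g.uι q.2).prod ∈ g.uGrading (l.map Prod.fst).sum) :
    g.uDecomp (l.map fun q => g.uι q.2).prod =
      DirectSum.of (fun α => g.uGrading α) (l.map Prod.fst).sum ⟨_, h⟩ := by
  induction l with
  | nil =>
    simp only [List.map_nil, List.prod_nil, map_one]
    rfl
  | cons q l ih =>
    have hq := hl q (by simp)
    have hl' : ∀ r ∈ l, r.2 ∈ g.comp r.1 := fun r hr => hl r (by simp [hr])
    have h' : (l.map fun q => g.uι q.2).prod ∈ g.uGrading (l.map Prod.fst).sum :=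
      Submodule.subset_span ⟨l, hl', rfl, rfl⟩
    simp only [List.map_cons, List.prod_cons, map_mul, ih hl' h', uDecomp_uι,
      g.uDecompLin_of_mem hq, DirectSum.of_mul_of]
    rfl

/-- `u(g)` is a `Γ`-graded algebra. -/
noncomputable instance uGrading_gradedAlgebra (g : RestrictedLieColorAlgebra p χ L) :
    GradedAlgebra g.uGrading :=
  GradedAlgebra.ofAlgHom g.uGrading g.uDecomp
    (by
      apply RingQuot.ringQuot_ext'
      apply TensorAlgebra.hom_ext
      ext x
      have hx : x ∈ ⨆ α, g.comp α := by
        rw [g.isInternal.submodule_iSup_eq_top]; trivial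
      change DirectSum.coeAlgHom g.uGrading (g.uDecomp (g.uι x)) = g.uι x
      rw [uDecomp_uι]
      induction hx using Submodule.iSup_induction' with
      | mem α x hx => rw [g.uDecompLin_of_mem hx]; simp
      | zero => simp
      | add x y _ _ hx hy => rw [map_add, map_add, hx, hy, map_add])
    (by
      rintro α ⟨x, hx⟩
      change g.uDecomp x = _
      induction hx using Submodule.span_induction with
      | mem x h =>
        obtain ⟨l, hl, rfl, rfl⟩ := h
        exact g.uDecomp_prod l hl _
      | zero =>
        rw [map_zero]
        exact (map_zero (DirectSum.of (fun α => g.uGrading α) α)).symm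
      | add x y hx hy h1 h2 => rw [map_add, h1, h2, ← map_add]; rfl
      | smul c x hx h1 =>
        rw [map_smul, h1, ← DirectSum.lof_eq_of F, ← map_smul]; rfl)

end

end RestrictedLieColorAlgebra

/-! Two things have to be proved: a PBW theorem for `u(g)`, and three properties of the functional φ
that reads off the coefficient of `e^τ`.

PBW. Sorting words and reducing high powers shows that the restricted monomials span, so only a
lower bound on dim `u(g)` is missing. Unipotence makes every `ad x` nilpotent for `x` homogeneous,
and an Engel argument (`Flag.exists_normalizing`, `Flag.exists_extension`) builds `g` from 0 by
adjoining one homogeneous element at a time, each subalgebra `H` being an ideal of codimension one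
in the next. For `g = H + F x`, put `A = u(H)`. The derivation `ad x` of `H` extends to a twisted
derivation δ of `A`, with twist σ, and `x` acts as `t` on `A[t; σ, δ] / (t^(k+1) - c)`, where `k + 1
= p`, `c = x^[p]` for `x` even and `k + 1 = 2`, `c = [x,x]/2` for `x` odd. This defines a
`u(g)`-module generated by `1` (`IsExtension.exists_representation`), so dim `u(g)` is at least
`(k+1)` dim `u(H)`. The product of these factors depends only on the dimensions of the components of
`g`, so the bound serves every homogeneous basis.

Frobenius form. Filter `u(g)` by word length. Up to shorter words, letters commute up to nonzero
scalars, and φ kills all words shorter than `∑ τ(i)`. Invariance is associativity. For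
nondegeneracy, a longest monomial `e^a` in a nonzero element is paired with `e^(τ-a)`.

Color symmetry reduces to moving one generator `e_i` past a monomial `z`. The color commutator of
`e_i` and `z` is no longer than `z`, so φ kills it unless `z = e^τ`; there the degrees of the
commutator and of `e^τ` differ unless `e_i` has degree 0. In that last case `e_i` is even, hence
nilpotent in `u(g)` by unipotence, so `ad e_i` is nilpotent and its eigenvalue on `e^τ` modulo
shorter words is 0 (`coord_last_commutator_eq_zero`). -/

/-! ### Characteristic `p` identities in associative algebras -/

theorem natCast_choose_pred_eq {R : Type*} [Ring R] {p : ℕ} (hp : p.Prime) (hR : (p : R) = 0) {k : ℕ}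
    (hk : k < p) : (((p - 1).choose k : ℕ) : R) = (-1) ^ k := by
  induction k with
  | zero => simp
  | succ k ih =>
    have h1 : p.choose (k + 1) = (p - 1).choose k + (p - 1).choose (k + 1) := by
      obtain ⟨q, rfl⟩ : ∃ q, p = q + 1 := ⟨p - 1, by have := hp.pos; omega⟩
      exact Nat.choose_succ_succ q k
    obtain ⟨c, hc⟩ := hp.dvd_choose_self (Nat.succ_ne_zero k) hk
    have h2 : ((p.choose (k + 1) : ℕ) : R) = 0 := by rw [hc]; push_cast; rw [hR, zero_mul]
    rw [h1, Nat.cast_add, ih (by omega)] at h2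
    rw [pow_succ, mul_neg_one]
    exact (neg_eq_of_add_eq_zero_right h2).symm

/-- The binomial coefficient is `(-1)^i` modulo `p`, and it cancels the sign of `(-y)^(p-1-i)`
because `p - 1` is even. Applied to left and right multiplications, this turns `(ad y)^(p-1)` into
the sum that a derivation produces from a `p`-th power. -/
theorem Commute.sub_pow_prime_pred {R : Type*} [Ring R] {p : ℕ} (hp : p.Prime) (hodd : Odd p)
    (hR : (p : R) = 0) {x y : R} (h : Commute x y) :
    (x - y) ^ (p - 1) = ∑ i ∈ Finset.range p, x ^ i * y ^ (p - 1 - i) := by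
  have hpos := hp.pos
  rw [sub_eq_add_neg, h.neg_right.add_pow, Nat.sub_add_cancel hpos]
  refine Finset.sum_congr rfl fun i hi => ?_
  have hi' := Finset.mem_range.1 hi
  rw [natCast_choose_pred_eq hp hR hi', neg_pow y, mul_assoc, mul_assoc,
    ((Commute.neg_one_left (y ^ (p - 1 - i))).pow_left i).symm.eq, ← mul_assoc ((-1) ^ _), ← pow_add,
    Nat.sub_add_cancel (by omega), Even.neg_one_pow, one_mul]
  rcases hodd with ⟨m, hm⟩
  exact ⟨m, by omega⟩

theorem Commute.add_pow_prime_of_cast_eq_zero {R : Type*} [Semiring R] {p : ℕ} (hp : p.Prime)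
    (hR : (p : R) = 0) {x y : R} (h : Commute x y) : (x + y) ^ p = x ^ p + y ^ p := by
  obtain ⟨r, hr⟩ := h.exists_add_pow_prime_eq hp
  rw [hr, hR, zero_mul, zero_mul, zero_mul, add_zero]

theorem Commute.sub_pow_prime_pow_of_cast_eq_zero {R : Type*} [Ring R] {p : ℕ} (hp : p.Prime)
    (hR : (p : R) = 0) {x y : R} (h : Commute x y) (n : ℕ) :
    (x - y) ^ p ^ n = x ^ p ^ n - y ^ p ^ n := by
  obtain ⟨r, hr⟩ := (h.sub_left (Commute.refl y)).exists_add_pow_prime_pow_eq hp n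
  rw [sub_add_cancel, hR, zero_mul, zero_mul, zero_mul, add_zero] at hr
  rw [hr, add_sub_cancel_right]

/-- A "twisted derivation" version of the iterated commutator expansion, valid for the `p`-th powers
(commuting twist) in characteristic `p` and for squares (anticommuting twist). -/
theorem pow_mul_twisted {F A R : Type*} [Field F] [Ring A] [Algebra F A] [Ring R] [Algebra F R]
    (φ : A →ₗ[F] R) (σ δ : A →ₗ[F] A) (X : R)
    (h : ∀ a, X * φ a = φ (σ a) * X + φ (δ a)) (q : ℕ)
    (hq : (q.Prime ∧ (q : F) = 0 ∧ ∀ a, σ (δ a) = δ (σ a)) ∨ (q = 2 ∧ ∀ a, σ (δ a) = -δ (σ a)))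
    (a : A) : X ^ q * φ a = φ (σ^[q] a) * X ^ q + φ (δ^[q] a) := by
  let Λ : Module.End F (A →ₗ[F] R) :=
    { toFun := fun f => (LinearMap.mulLeft F X).comp f
      map_add' := fun f g => by ext; simp [mul_add]
      map_smul' := fun c f => by ext; simp }
  let Φ : Module.End F (A →ₗ[F] R) :=
    { toFun := fun f => (LinearMap.mulRight F X).comp (f.comp σ)
      map_add' := fun f g => by ext; simp [add_mul]
      map_smul' := fun c f => by ext; simp }
  let Ψ : Module.End F (A →ₗ[F] R) :=
    { toFun := fun f => f.comp δ
      map_add' := fun f g => by ext; simp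
      map_smul' := fun c f => by ext; simp }
  have hΛ (f) (a) : Λ f a = X * f a := rfl
  have hΦ (f) (a) : Φ f a = f (σ a) * X := rfl
  have hΨ (f) (a) : Ψ f a = f (δ a) := rfl
  -- The hypothesis `h` says that Λ and Φ + Ψ agree at `φ`. Since they commute, all their powers
  -- agree at `φ`, and it remains to expand `(Φ + Ψ)^q`, whose mixed terms vanish.
  have hc : Commute Λ (Φ + Ψ) := by
    refine LinearMap.ext fun f => LinearMap.ext fun a => ?_
    simp [hΛ, hΦ, hΨ, mul_add, mul_assoc]
  have h0 : Λ φ = (Φ + Ψ) φ := LinearMap.ext fun a => by simp [hΛ, hΦ, hΨ, h]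
  have h1 (k : ℕ) : (Λ ^ k) φ = ((Φ + Ψ) ^ k) φ := by
    induction k with
    | zero => rfl
    | succ k ih =>
      rw [pow_succ, pow_succ, Module.End.mul_apply, Module.End.mul_apply, h0,
        ← Module.End.mul_apply, (hc.pow_left k).eq, Module.End.mul_apply, ih,
        ← Module.End.mul_apply, ← Module.End.mul_apply, ← pow_succ, ← pow_succ']
  have hΛk (k : ℕ) (f) (a) : (Λ ^ k) f a = X ^ k * f a := by
    induction k generalizing f with
    | zero => simp
    | succ k ih => rw [pow_succ, Module.End.mul_apply, ih, hΛ, ← mul_assoc, ← pow_succ]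
  have hΦk (k : ℕ) (f) (a) : (Φ ^ k) f a = f (σ^[k] a) * X ^ k := by
    induction k generalizing f with
    | zero => simp
    | succ k ih =>
      rw [pow_succ, Module.End.mul_apply, ih, hΦ, mul_assoc, ← pow_succ',
        Function.iterate_succ_apply']
  have hΨk (k : ℕ) (f) (a) : (Ψ ^ k) f a = f (δ^[k] a) := by
    induction k generalizing f with
    | zero => simp
    | succ k ih => rw [pow_succ, Module.End.mul_apply, ih, hΨ, Function.iterate_succ_apply']
  have h2 : (Φ + Ψ) ^ q = Φ ^ q + Ψ ^ q := by
    rcases hq with ⟨hp, hF, hs⟩ | ⟨rfl, hs⟩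
    · refine Commute.add_pow_prime_of_cast_eq_zero hp ?_ ?_
      · rw [← map_natCast (algebraMap F (Module.End F (A →ₗ[F] R))), hF, map_zero]
      · refine LinearMap.ext fun f => LinearMap.ext fun a => ?_
        simp [hΦ, hΨ, hs]
    · have : Φ * Ψ + Ψ * Φ = 0 := by
        refine LinearMap.ext fun f => LinearMap.ext fun a => ?_
        simp [hΦ, hΨ, hs]
      rw [sq, sq, sq, add_mul, mul_add, mul_add]
      calc _ = Φ * Φ + Ψ * Ψ + (Φ * Ψ + Ψ * Φ) := by abel
        _ = _ := by rw [this, add_zero]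
  rw [← hΛk, h1, h2, LinearMap.add_apply, LinearMap.add_apply, hΦk, hΨk]

open Polynomial in
/-- Jacobson's formula for the `p`-th power of a sum, in characteristic `p`. -/
theorem add_pow_prime_eq_sum_coeff {F R : Type*} [Field F] [Ring R] [Algebra F R] {p : ℕ}
    (hp : p.Prime) (hodd : Odd p) (hF : ∀ i : ℕ, (i : F) = 0 ↔ p ∣ i) (a b : R) :
    (a + b) ^ p = a ^ p + b ^ p + ∑ i ∈ Finset.Icc 1 (p - 1), (i : F)⁻¹ •
      (((fun Z : R[X] => (C a * X + C b) * Z - Z * (C a * X + C b))^[p - 1]) (C a)).coeff (i - 1) := by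
  set Y : R[X] := C a * X + C b with hY
  have hR : (p : R[X]) = 0 := by
    rw [← map_natCast (algebraMap F R[X]), (hF p).2 dvd_rfl, map_zero]
  have hpos := hp.pos
  have hadj (m : ℕ) (Z : R[X]) : ((fun Z : R[X] => Y * Z - Z * Y)^[m]) Z =
      ((LinearMap.mulLeft ℤ Y - LinearMap.mulRight ℤ Y) ^ m) Z := by
    induction m with
    | zero => rfl
    | succ m ih => rw [Function.iterate_succ_apply', ih, pow_succ']; simp
  have hder (m : ℕ) : derivative (Y ^ m) =
      ∑ i ∈ Finset.range m, Y ^ i * (C a * Y ^ (m - 1 - i)) := by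
    induction m with
    | zero => simp
    | succ m ih =>
      rw [pow_succ', derivative_mul, ih, Finset.sum_range_succ', Finset.mul_sum]
      have : derivative Y = C a := by simp [hY]
      rw [this, add_comm]
      simp only [pow_zero, one_mul, Nat.sub_zero, Nat.add_sub_cancel]
      congr 1
      refine Finset.sum_congr rfl fun i hi => ?_
      rw [pow_succ', mul_assoc]
      congr 4
      omega
  -- The product rule gives `∑ Y^i a Y^(p-1-i)`, which is `(L_Y - R_Y)^(p-1)` applied to `a`. The
  -- derivative determines the coefficients of `Y^p` in degrees 1 to `p - 1`; the two extreme ones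
  -- are `b^p` and `a^p`, and evaluation at 1 recovers `(a + b)^p`.
  have hder' : derivative (Y ^ p) = ((fun Z : R[X] => Y * Z - Z * Y)^[p - 1]) (C a) := by
    rw [hadj, Commute.sub_pow_prime_pred hp hodd, hder, LinearMap.sum_apply]
    · refine Finset.sum_congr rfl fun i _ => ?_
      rw [Module.End.mul_apply, LinearMap.pow_mulRight, LinearMap.pow_mulLeft]; rfl
    · refine LinearMap.ext fun Z => ?_
      change ((p : Module.End ℤ R[X])) Z = 0
      rw [Module.End.natCast_apply, nsmul_eq_mul, hR, zero_mul]
    · exact LinearMap.commute_mulLeft_right (R := ℤ) Y Y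
  have hdeg : Y.natDegree ≤ 1 := by
    rw [hY]
    refine natDegree_add_le_of_degree_le ?_ (by simp)
    exact (natDegree_C_mul_le _ _).trans natDegree_X_le
  have hdegp : (Y ^ p).natDegree ≤ p := by
    simpa using natDegree_pow_le_of_le p hdeg
  have heval : (Y ^ p).eval 1 = (a + b) ^ p := by
    -- `R` is noncommutative, so multiplicativity of evaluation at 1 is checked by hand for the
    -- factor `Y`.
    have h1 (Z : R[X]) : (Y * Z).eval 1 = (a + b) * Z.eval 1 := by
      rw [hY, add_mul, eval_add, mul_assoc, eval_C_mul, eval_C_mul, X_mul, eval_mul_X, mul_one,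
        add_mul]
    have h2 (m : ℕ) : (Y ^ m).eval 1 = (a + b) ^ m := by
      induction m with
      | zero => simp
      | succ m ih => rw [pow_succ', h1, ih, pow_succ']
    exact h2 p
  have hcoeff (i : ℕ) (hi : i ∈ Finset.Icc 1 (p - 1)) : (Y ^ p).coeff i = (i : F)⁻¹ •
      (((fun Z : R[X] => Y * Z - Z * Y)^[p - 1]) (C a)).coeff (i - 1) := by
    have hi' := Finset.mem_Icc.1 hi
    rw [← hder', coeff_derivative, Nat.sub_add_cancel hi'.1]
    have : ((i - 1 : ℕ) : R) + 1 = algebraMap F R i := by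
      rw [← Nat.cast_succ, Nat.succ_eq_add_one, Nat.sub_add_cancel hi'.1, map_natCast]
    rw [this, ← Algebra.commutes, ← Algebra.smul_def, smul_smul, inv_mul_cancel₀, one_smul]
    rw [Ne, hF]
    intro h
    have := Nat.le_of_dvd (by omega) h
    omega
  rw [← heval, eval_eq_sum_range' (Nat.lt_succ_of_le hdegp)]
  simp only [one_pow, mul_one]
  rw [Finset.sum_range_succ, Finset.sum_range_eq_add_Ico _ hpos]
  have h0 : (Y ^ p).coeff 0 = b ^ p := by
    rw [← constantCoeff_apply, map_pow]; simp [hY]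
  have hpp : (Y ^ p).coeff p = a ^ p := by
    have := coeff_pow_of_natDegree_le (m := p) hdeg
    rw [mul_one] at this
    rw [this]; simp [hY]
  rw [h0, hpp, ← Finset.sum_congr rfl hcoeff]
  have : Finset.Ico 1 p = Finset.Icc 1 (p - 1) := by ext; simp; omega
  rw [this]
  abel

/-! ### Bicharacters -/

namespace Bicharacter

variable {F : Type*} [Field F] {Γ : Type*} [AddCommGroup Γ] (χ : Bicharacter F Γ)

theorem toFun_zero_right (α : Γ) : χ.toFun α 0 = 1 := by
  have := χ.add_right α 0 0
  rwa [add_zero, left_eq_mul] at this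

theorem toFun_zero_left (α : Γ) : χ.toFun 0 α = 1 := by
  have := χ.add_left 0 0 α
  rwa [add_zero, left_eq_mul] at this

theorem toFun_nsmul_right (α β : Γ) (k : ℕ) : χ.toFun α (k • β) = χ.toFun α β ^ k := by
  induction k with
  | zero => rw [zero_nsmul, toFun_zero_right, pow_zero]
  | succ k ih => rw [succ_nsmul, add_right, ih, pow_succ]

theorem toFun_nsmul_left (α β : Γ) (k : ℕ) : χ.toFun (k • α) β = χ.toFun α β ^ k := by
  induction k with
  | zero => rw [zero_nsmul, toFun_zero_left, pow_zero]
  | succ k ih => rw [succ_nsmul, add_left, ih, pow_succ]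

theorem val_mul_swap (α β : Γ) : (χ.toFun α β : F) * χ.toFun β α = 1 := by
  rw [← Units.val_mul, χ.mul_swap, Units.val_one]

theorem val_self_of_not_even {α : Γ} (h : ¬ χ.Even α) : (χ.toFun α α : F) = -1 := by
  refine (mul_self_eq_one_iff.1 (χ.val_mul_swap α α)).resolve_left fun h' => h ?_
  exact Units.ext h'

variable {χ}

theorem Even.nsmul {α : Γ} (h : χ.Even α) (k : ℕ) : χ.Even (k • α) := by
  unfold Even at *
  rw [toFun_nsmul_left, toFun_nsmul_right, h, one_pow, one_pow]

theorem even_add_self (α : Γ) : χ.Even (α + α) := by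
  unfold Even
  rw [add_left, add_right, χ.mul_swap, one_mul]

theorem even_zero : χ.Even (0 : Γ) := χ.toFun_zero_left 0

end Bicharacter

/-! ### Identities in Lie color algebras -/

namespace LieColorAlgebra

variable {F : Type*} [Field F] {Γ : Type*} [AddCommGroup Γ] [DecidableEq Γ]
  {χ : Bicharacter F Γ} {L : Type*} [AddCommGroup L] [Module F L] (g : LieColorAlgebra χ L)

theorem iSup_comp : ⨆ α, g.comp α = ⊤ := g.isInternal.submodule_iSup_eq_top

theorem homogeneous_induction {P : L → Prop} (hom : ∀ α x, x ∈ g.comp α → P x) (zero : P 0)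
    (add : ∀ x y, P x → P y → P (x + y)) (x : L) : P x := by
  have hx : x ∈ ⨆ α, g.comp α := by rw [g.iSup_comp]; trivial
  induction hx using Submodule.iSup_induction' with
  | mem α x hx => exact hom α x hx
  | zero => exact zero
  | add x y _ _ hx hy => exact add x y hx hy

/-- The linear map acting on the component of degree `β` by the scalar `(α, β)`. -/
noncomputable def twist (α : Γ) : L →ₗ[F] L :=
  letI := g.isInternal.chooseDecomposition
  (DirectSum.toModule F Γ L fun β => (χ.toFun α β : F) • (g.comp β).subtype) ∘ₗ
    (DirectSum.decomposeLinearEquiv g.comp).toLinearMap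

theorem twist_apply (α : Γ) {β : Γ} {x : L} (hx : x ∈ g.comp β) :
    g.twist α x = (χ.toFun α β : F) • x := by
  let _ := g.isInternal.chooseDecomposition
  simp only [twist, LinearMap.comp_apply, LinearEquiv.coe_coe,
    DirectSum.decomposeLinearEquiv_apply, DirectSum.decompose_of_mem _ hx]
  rw [← DirectSum.lof_eq_of F, DirectSum.toModule_lof]
  rfl

variable {g}

/-- The color Jacobi identity in the form "`ad x` is a color derivation": skew symmetry brings the
three terms to this shape and the unit `(γ, α)` cancels. -/
theorem br_br {α β γ : Γ} {x y z : L} (hx : x ∈ g.comp α) (hy : y ∈ g.comp β) (hz : z ∈ g.comp γ) :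
    g.br x (g.br y z) = g.br (g.br x y) z + (χ.toFun α β : F) • g.br y (g.br x z) := by
  have h := g.jacobi hx hy hz
  rw [g.skew hx hz, g.skew (g.br_mem hx hy) hz, map_neg, map_smul, smul_neg, smul_neg,
    smul_smul, smul_smul, χ.add_right, Units.val_mul, mul_comm (χ.toFun γ α : F) (χ.toFun γ β : F),
    ← mul_assoc, χ.val_mul_swap, one_mul, mul_comm, mul_smul, add_assoc, ← neg_add, ← sub_eq_add_neg,
    sub_eq_zero, ← smul_add] at h
  have h' := (smul_right_injective L (χ.toFun γ α).ne_zero) h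
  rw [h', add_comm]

theorem br_self_of_even (h2 : (2 : F) ≠ 0) {α : Γ} (hα : χ.Even α) {x : L} (hx : x ∈ g.comp α) :
    g.br x x = 0 := by
  have h := g.skew hx hx
  rw [hα, Units.val_one, one_smul, eq_neg_iff_add_eq_zero, ← two_smul F] at h
  exact (smul_eq_zero.1 h).resolve_left h2

theorem br_br_self {α β : Γ} (hα : ¬ χ.Even α) {x y : L} (hx : x ∈ g.comp α) (hy : y ∈ g.comp β) :
    g.br (g.br x x) y = (2 : F) • g.br x (g.br x y) := by
  have h := br_br hx hx hy
  rw [χ.val_self_of_not_even hα, neg_smul, one_smul, ← sub_eq_add_neg, eq_sub_iff_add_eq] at h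
  rw [two_smul, h]

theorem br_br_self' {α : Γ} (hα : ¬ χ.Even α) {x : L} (hx : x ∈ g.comp α) (y : L) :
    g.br (g.br x x) y = (2 : F) • g.br x (g.br x y) := by
  induction y using g.homogeneous_induction with
  | hom β y hy => exact br_br_self hα hx hy
  | zero => simp
  | add y z hy hz => simp only [map_add, smul_add, hy, hz]

/-- The element `[[x,x],x]` is `2[x,[x,x]]` by Jacobi and `-[x,[x,x]]` by skew symmetry, so three
times `[x,[x,x]]` vanishes. It gives `[x,c] = 0` for `c = [x,x]/2`. -/
theorem br_self_br_self (h3 : (3 : F) ≠ 0) {α : Γ} (hα : ¬ χ.Even α) {x : L} (hx : x ∈ g.comp α) :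
    g.br x (g.br x x) = 0 := by
  have h := br_br_self hα hx hx
  rw [g.skew hx (g.br_mem hx hx), χ.add_left, Units.val_mul, χ.val_self_of_not_even hα, mul_neg_one,
    neg_neg, one_smul, neg_eq_iff_add_eq_zero, add_comm] at h
  have h' : (3 : F) • g.br x (g.br x x) = 0 := by
    rw [← h, ← two_add_one_eq_three, add_smul, one_smul]
  exact (smul_eq_zero.1 h').resolve_left h3

theorem adCoeff_mem {γ : Γ} {x y : L} (hx : x ∈ g.comp γ) (hy : y ∈ g.comp γ) (m j : ℕ) :
    g.adCoeff x y m j ∈ g.comp ((m + 1) • γ) := by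
  induction m generalizing j with
  | zero =>
    cases j
    · simpa [adCoeff] using hx
    · simp [adCoeff]
  | succ m ih =>
    have : ((m + 1 + 1) • γ) = γ + (m + 1) • γ := succ_nsmul' _ _
    rw [this]
    cases j
    · exact g.br_mem hy (ih 0)
    · exact add_mem (g.br_mem hx (ih _)) (g.br_mem hy (ih _))

theorem adCoeff_mem_of_closed {H : Submodule F L} (hH : ∀ x ∈ H, ∀ y ∈ H, g.br x y ∈ H)
    {x y : L} (hx : x ∈ H) (hy : y ∈ H) (m j : ℕ) : g.adCoeff x y m j ∈ H := by
  induction m generalizing j with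
  | zero =>
    cases j
    · simpa [adCoeff] using hx
    · simp [adCoeff]
  | succ m ih =>
    cases j
    · exact hH _ hy _ (ih 0)
    · exact add_mem (hH _ hx _ (ih _)) (hH _ hy _ (ih _))

end LieColorAlgebra

/-! ### Universal property of `u(g)`, the `p`-map and nilpotency -/

namespace RestrictedLieColorAlgebra

variable {F : Type*} [Field F] {p : ℕ} {Γ : Type*} [AddCommGroup Γ] [DecidableEq Γ]
  {χ : Bicharacter F Γ} {L : Type*} [AddCommGroup L] [Module F L]
  (g : RestrictedLieColorAlgebra p χ L)

section Lift

variable {R : Type*} [Ring R] [Algebra F R]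

/-- The algebra map out of `u(g)` given by a linear map satisfying the defining relations. -/
noncomputable def lift (ρ : L →ₗ[F] R)
    (hbr : ∀ α β x y, x ∈ g.comp α → y ∈ g.comp β →
      ρ x * ρ y - (χ.toFun α β : F) • (ρ y * ρ x) = ρ (g.br x y))
    (hpow : ∀ α x, χ.Even α → x ∈ g.comp α → ρ x ^ p = ρ (g.pmap x)) :
    g.RestrictedEnveloping →ₐ[F] R :=
  RingQuot.liftAlgHom F ⟨TensorAlgebra.lift F ρ, fun a b h => by
    induction h with
    | @br α β x y hx hy =>
      rw [map_sub, map_smul, map_mul, map_mul, TensorAlgebra.lift_ι_apply,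
        TensorAlgebra.lift_ι_apply, TensorAlgebra.lift_ι_apply, hbr α β x y hx hy]
    | @pow α x hα hx =>
      rw [map_pow, TensorAlgebra.lift_ι_apply, TensorAlgebra.lift_ι_apply, hpow α x hα hx]⟩

theorem lift_uι (ρ : L →ₗ[F] R) (hbr) (hpow) (x : L) : g.lift ρ hbr hpow (g.uι x) = ρ x := by
  exact (RingQuot.liftAlgHom_mkAlgHom_apply F _ _ _).trans (TensorAlgebra.lift_ι_apply _ _)

/-- Jacobson's formula in `R` matches the axiom for `(x + y)^[p]` term by term. Hence the `p`-th
power relation need only be checked on summands. -/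
theorem pow_pmap_add (hp : p.Prime) (hodd : Odd p) (hF : ∀ i : ℕ, (i : F) = 0 ↔ p ∣ i)
    (ρ : L →ₗ[F] R)
    (hbr : ∀ α β x y, x ∈ g.comp α → y ∈ g.comp β →
      ρ x * ρ y - (χ.toFun α β : F) • (ρ y * ρ x) = ρ (g.br x y))
    {γ : Γ} (hγ : χ.Even γ) {x y : L} (hx : x ∈ g.comp γ) (hy : y ∈ g.comp γ)
    (hxp : ρ x ^ p = ρ (g.pmap x)) (hyp : ρ y ^ p = ρ (g.pmap y)) :
    ρ (x + y) ^ p = ρ (g.pmap (x + y)) := by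
  -- All brackets involved lie in degrees that are multiples of the even degree `γ`, where the color
  -- commutator is the ordinary one.
  have hχ (m : ℕ) : χ.toFun γ (m • γ) = 1 := by rw [χ.toFun_nsmul_right, hγ, one_pow]
  have hc (m : ℕ) {u v : L} (hu : u ∈ g.comp γ) (hv : v ∈ g.comp (m • γ)) :
      ρ (g.br u v) = ρ u * ρ v - ρ v * ρ u := by
    rw [← hbr _ _ _ _ hu hv, hχ, Units.val_one, one_smul]
  obtain ⟨T, hT⟩ : ∃ T : Polynomial R → Polynomial R, T = fun Z => (.C (ρ x) * .X + .C (ρ y)) * Z -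
      Z * (.C (ρ x) * .X + .C (ρ y)) := ⟨_, rfl⟩
  have key (m j : ℕ) : (T^[m] (.C (ρ x))).coeff j = ρ (g.adCoeff x y m j) := by
    induction m generalizing j with
    | zero =>
      cases j with
      | zero => simp [LieColorAlgebra.adCoeff]
      | succ j => simp [LieColorAlgebra.adCoeff]
    | succ m ih =>
      rw [Function.iterate_succ_apply']
      generalize T^[m] (.C (ρ x)) = W at ih ⊢
      simp only [hT, add_mul, mul_add, mul_assoc, Polynomial.X_mul, Polynomial.coeff_sub,
        Polynomial.coeff_add]
      simp only [← mul_assoc, Polynomial.coeff_C_mul, Polynomial.coeff_mul_C]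
      have hm := fun j => LieColorAlgebra.adCoeff_mem hx hy m j
      cases j with
      | zero =>
        simp only [Polynomial.mul_coeff_zero, Polynomial.coeff_X_zero, mul_zero, zero_add,
          Polynomial.coeff_C_zero, ih]
        rw [LieColorAlgebra.adCoeff, hc _ hy (hm 0)]
      | succ j =>
        simp only [Polynomial.coeff_mul_X, Polynomial.coeff_C_mul, Polynomial.coeff_mul_C, ih]
        rw [LieColorAlgebra.adCoeff, map_add, hc _ hy (hm _), hc _ hx (hm _)]
        abel
  rw [map_add, add_pow_prime_eq_sum_coeff hp hodd hF, g.pmap_add hγ hx hy, ← hT]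
  simp only [key, map_add, map_sum, map_smul, hxp, hyp]

theorem pow_pmap_smul (ρ : L →ₗ[F] R) {γ : Γ} (hγ : χ.Even γ) {x : L} (hx : x ∈ g.comp γ) (r : F)
    (hxp : ρ x ^ p = ρ (g.pmap x)) : ρ (r • x) ^ p = ρ (g.pmap (r • x)) := by
  rw [g.pmap_smul r hγ hx, map_smul, map_smul, smul_pow, hxp]

end Lift

theorem adjoin_range_uι : Algebra.adjoin F (Set.range g.uι) = ⊤ := by
  have h : (Algebra.adjoin F (Set.range (TensorAlgebra.ι F (M := L)))).map g.umk = ⊤ := by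
    rw [TensorAlgebra.adjoin_range_ι, Algebra.map_top, AlgHom.range_eq_top]
    exact RingQuot.mkAlgHom_surjective F g.Rel
  rw [AlgHom.map_adjoin, ← Set.range_comp] at h
  exact h

/-- An induction principle for `u(g)`: products may be built from the left by homogeneous
generators. -/
theorem enveloping_induction {P : g.RestrictedEnveloping → Prop} (one : P 1)
    (add : ∀ a b, P a → P b → P (a + b)) (smul : ∀ (r : F) a, P a → P (r • a))
    (mul : ∀ α x a, x ∈ g.comp α → P a → P (g.uι x * a)) (a : g.RestrictedEnveloping) : P a := by
  have zero : P 0 := by simpa using smul 0 1 one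
  have hmul (x : L) (a) (ha : P a) : P (g.uι x * a) := by
    induction x using g.homogeneous_induction with
    | hom β y hy => exact mul β y a hy ha
    | zero => simpa using zero
    | add y z hy hz => rw [map_add, add_mul]; exact add _ _ hy hz
  have ha : a ∈ Algebra.adjoin F (Set.range g.uι) := by rw [g.adjoin_range_uι]; trivial
  suffices h : ∀ b, P b → P (a * b) by simpa using h 1 one
  induction ha using Algebra.adjoin_induction with
  | mem x hx => obtain ⟨x, rfl⟩ := hx; exact fun b hb => hmul x b hb
  | algebraMap r => intro b hb; rw [← Algebra.smul_def]; exact smul r b hb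
  | add x y _ _ hx hy => intro b hb; rw [add_mul]; exact add _ _ (hx b hb) (hy b hb)
  | mul x y _ _ hx hy => intro b hb; rw [mul_assoc]; exact hx _ (hy b hb)

theorem uι_pow_pow {α : Γ} (hα : χ.Even α) {x : L} (hx : x ∈ g.comp α) (n : ℕ) :
    g.uι x ^ p ^ n = g.uι (g.pmap^[n] x) := by
  induction n generalizing α x with
  | zero => simp
  | succ n ih =>
    rw [pow_succ', pow_mul, g.uι_pow hα hx, ih (hα.nsmul p) (g.pmap_mem hα hx),
      Function.iterate_succ_apply]

theorem br_iterate_pow {α : Γ} (hα : χ.Even α) {x : L} (hx : x ∈ g.comp α) (n : ℕ) (y : L) :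
    (g.br x)^[p ^ n] y = g.br (g.pmap^[n] x) y := by
  induction n generalizing α x y with
  | zero => simp
  | succ n ih =>
    rw [pow_succ', Function.iterate_mul, Function.iterate_succ_apply,
      ← ih (hα.nsmul p) (g.pmap_mem hα hx)]
    have : (g.br x)^[p] = g.br (g.pmap x) := funext fun y => (g.br_pmap hα hx y).symm
    rw [this]

theorem pmap_zero (hp : p ≠ 0) : g.pmap 0 = 0 := by
  have := g.pmap_smul (γ := 0) (x := 0) 0 Bicharacter.even_zero (zero_mem _)
  rwa [zero_smul, zero_pow hp, zero_smul] at this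

theorem pmap_iterate_mem {α : Γ} (hα : χ.Even α) {x : L} (hx : x ∈ g.comp α) (n : ℕ) :
    g.pmap^[n] x ∈ g.comp (p ^ n • α) := by
  induction n with
  | zero => simpa using hx
  | succ n ih =>
    rw [Function.iterate_succ_apply', pow_succ', mul_smul]
    exact g.pmap_mem (hα.nsmul _) ih

variable {g}

/-- For `x` even, `(ad x)^(p^n)` is `ad` of the iterated `p`-map of `x`. For `x` odd, `(ad x)^2` is
half of `ad [x,x]`, and `[x,x]` is even. -/
theorem IsUnipotent.exists_br_iterate_eq_zero (hg : g.IsUnipotent) (h2 : (2 : F) ≠ 0) {α : Γ}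
    {x : L} (hx : x ∈ g.comp α) : ∃ n, ∀ y, (g.br x)^[n] y = 0 := by
  by_cases hα : χ.Even α
  · obtain ⟨n, -, hn⟩ := hg α x hα hx
    exact ⟨p ^ n, fun y => by rw [g.br_iterate_pow hα hx, hn]; simp⟩
  · obtain ⟨n, -, hn⟩ := hg _ _ (χ.even_add_self α) (g.br_mem hx hx)
    refine ⟨2 * p ^ n, fun y => ?_⟩
    have h1 : (g.br x)^[2] = ⇑((2 : F)⁻¹ • g.br (g.br x x)) := by
      funext z
      rw [LinearMap.smul_apply, LieColorAlgebra.br_br_self' hα hx, smul_smul, inv_mul_cancel₀ h2,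
        one_smul]
      rfl
    rw [Function.iterate_mul, h1, ← Module.End.coe_pow, smul_pow, LinearMap.smul_apply,
      Module.End.coe_pow, g.br_iterate_pow (χ.even_add_self α) (g.br_mem hx hx), hn]
    simp

end RestrictedLieColorAlgebra

/-! ### Restricted subalgebras and Engel's theorem -/

namespace RestrictedLieColorAlgebra

variable {F : Type*} [Field F] {p : ℕ} {Γ : Type*} [AddCommGroup Γ] [DecidableEq Γ]
  {χ : Bicharacter F Γ} {L : Type*} [AddCommGroup L] [Module F L]
  (g : RestrictedLieColorAlgebra p χ L)

theorem mem_sup_span_singleton {H : Submodule F L} {x u : L} :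
    u ∈ H ⊔ F ∙ x ↔ ∃ y ∈ H, ∃ t : F, y + t • x = u := by
  simp only [Submodule.mem_sup, Submodule.mem_span_singleton, exists_exists_eq_and]

/-- A graded subspace closed under the bracket and the `p`-map. -/
structure IsRestrictedSub (H : Submodule F L) : Prop where
  graded : H ≤ ⨆ α, H ⊓ g.comp α
  br_mem : ∀ x ∈ H, ∀ y ∈ H, g.br x y ∈ H
  pmap_mem : ∀ α x, χ.Even α → x ∈ g.comp α → x ∈ H → g.pmap x ∈ H

namespace IsRestrictedSub

variable {g} {H : Submodule F L} (hH : g.IsRestrictedSub H)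
include hH

theorem homogeneous_induction {P : L → Prop} (hom : ∀ α x, x ∈ g.comp α → x ∈ H → P x) (zero : P 0)
    (add : ∀ x y, P x → P y → P (x + y)) {x : L} (hx : x ∈ H) : P x := by
  have hx' := hH.graded hx
  clear hx
  induction hx' using Submodule.iSup_induction' with
  | mem α x hx => exact hom α x hx.2 hx.1
  | zero => exact zero
  | add x y _ _ hx hy => exact add x y hx hy

/-- The Lie color algebra structure on a restricted graded subalgebra. -/
noncomputable def toLieColorAlgebra : LieColorAlgebra χ H where
  comp α := (g.comp α).comap H.subtype
  isInternal := by
    refine DirectSum.isInternal_submodule_of_iSupIndep_of_iSup_eq_top ?_ ?_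
    · intro i
      have hd : Disjoint (g.comp i) (⨆ j, ⨆ (_ : j ≠ i), g.comp j) :=
        g.isInternal.submodule_iSupIndep i
      rw [Submodule.disjoint_def] at hd ⊢
      intro x hx hx'
      have : (⨆ j, ⨆ (_ : j ≠ i), (g.comp j).comap H.subtype) ≤
          (⨆ j, ⨆ (_ : j ≠ i), g.comp j).comap H.subtype :=
        iSup₂_le fun j hj => Submodule.comap_mono (le_iSup₂_of_le j hj le_rfl)
      exact Subtype.ext (hd x.1 hx (this hx'))
    · rw [eq_top_iff]
      rintro ⟨x, hx⟩ -
      have key : ∃ y ∈ ⨆ α, (g.comp α).comap H.subtype, (y : L) = x := by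
        refine hH.homogeneous_induction (P := fun x => ∃ y ∈ ⨆ α, (g.comp α).comap H.subtype,
          (y : L) = x) ?_ ?_ ?_ hx
        · intro α x hx hxH
          exact ⟨⟨x, hxH⟩, Submodule.mem_iSup_of_mem α hx, rfl⟩
        · exact ⟨0, zero_mem _, rfl⟩
        · rintro _ _ ⟨y, hy, rfl⟩ ⟨z, hz, rfl⟩
          exact ⟨y + z, add_mem hy hz, rfl⟩
      obtain ⟨y, hy, hyx⟩ := key
      rwa [show (⟨x, hx⟩ : H) = y from Subtype.ext hyx.symm]
  br := LinearMap.mk₂ F (fun x y => ⟨g.br x y, hH.br_mem x x.2 y y.2⟩)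
    (fun x y z => Subtype.ext (by simp)) (fun r x y => Subtype.ext (by simp))
    (fun x y z => Subtype.ext (by simp)) (fun r x y => Subtype.ext (by simp))
  br_mem hx hy := g.br_mem hx hy
  skew hx hy := Subtype.ext (g.skew hx hy)
  jacobi hx hy hz := Subtype.ext (g.jacobi hx hy hz)

theorem coe_adCoeff (x y : H) (m j : ℕ) :
    (hH.toLieColorAlgebra.adCoeff x y m j : L) = g.adCoeff x y m j := by
  induction m generalizing j with
  | zero => cases j <;> rfl
  | succ m ih =>
    cases j with
    | zero => rw [LieColorAlgebra.adCoeff, LieColorAlgebra.adCoeff, ← ih]; rfl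
    | succ j => rw [LieColorAlgebra.adCoeff, LieColorAlgebra.adCoeff, ← ih, ← ih]; rfl

theorem coe_br_iterate (x y : H) (n : ℕ) :
    ((hH.toLieColorAlgebra.br x)^[n] y : L) = (g.br x)^[n] y := by
  induction n with
  | zero => rfl
  | succ n ih => rw [Function.iterate_succ_apply', Function.iterate_succ_apply', ← ih]; rfl

/-- The restricted Lie color algebra structure on a restricted graded subalgebra. -/
noncomputable def toAlgebra : RestrictedLieColorAlgebra p χ H where
  toLieColorAlgebra := hH.toLieColorAlgebra
  -- The `p`-map of `g` need not preserve `H` off the even homogeneous elements; the value 0 there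
  -- is a filler.
  pmap x := open Classical in if h : g.pmap x ∈ H then ⟨g.pmap x, h⟩ else 0
  pmap_mem {γ x} hγ hx := by
    rw [dif_pos (hH.pmap_mem γ x hγ hx x.2)]
    exact g.pmap_mem hγ hx
  pmap_add {γ x y} hγ hx hy := by
    rw [dif_pos (hH.pmap_mem γ x hγ hx x.2), dif_pos (hH.pmap_mem γ y hγ hy y.2),
      dif_pos (hH.pmap_mem γ (x + y : H) hγ ((g.comp γ).add_mem hx hy) (x + y).2)]
    refine Subtype.ext ?_
    simp only [Submodule.coe_add, Submodule.coe_sum, Submodule.coe_smul, hH.coe_adCoeff]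
    exact g.pmap_add hγ hx hy
  pmap_smul {γ x} r hγ hx := by
    rw [dif_pos (hH.pmap_mem γ x hγ hx x.2),
      dif_pos (hH.pmap_mem γ (r • x : H) hγ ((g.comp γ).smul_mem r hx) (r • x).2)]
    exact Subtype.ext (g.pmap_smul r hγ hx)
  br_pmap {γ x} hγ hx y := by
    rw [dif_pos (hH.pmap_mem γ x hγ hx x.2)]
    exact Subtype.ext ((g.br_pmap hγ hx y).trans (hH.coe_br_iterate x y p).symm)

theorem coe_br (x y : H) : (hH.toAlgebra.br x y : L) = g.br x y := rfl

theorem coe_pmap {α : Γ} (hα : χ.Even α) {x : H} (hx : (x : L) ∈ g.comp α) :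
    (hH.toAlgebra.pmap x : L) = g.pmap x := by
  have h : hH.toAlgebra.pmap x = ⟨g.pmap x, hH.pmap_mem α x hα hx x.2⟩ := dif_pos _
  rw [h]

theorem isUnipotent (hg : g.IsUnipotent) : hH.toAlgebra.IsUnipotent := by
  intro α x hα hx
  obtain ⟨n, hn, h0⟩ := hg α x hα hx
  refine ⟨n, hn, Subtype.ext ?_⟩
  rw [ZeroMemClass.coe_zero, ← h0]
  clear h0 hn
  induction n generalizing α x with
  | zero => rfl
  | succ n ih =>
    rw [Function.iterate_succ_apply, Function.iterate_succ_apply,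
      ih (p • α) _ (hα.nsmul p) (hH.toAlgebra.pmap_mem hα hx), hH.coe_pmap hα hx]

end IsRestrictedSub

/-- `x` can be adjoined to `H`, as a homogeneous element of degree `α`, so that `H` is an ideal of
codimension one in the span of `H` and `x`. -/
structure IsExtension (H : Submodule F L) (α : Γ) (x : L) : Prop where
  mem : x ∈ g.comp α
  notMem : x ∉ H
  br_mem : ∀ y ∈ H, g.br x y ∈ H
  pmap_mem : χ.Even α → g.pmap x ∈ H
  br_self_mem : ¬ χ.Even α → g.br x x ∈ H

/-- Subspaces obtained from `0` by successive extensions by one homogeneous element. -/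
inductive Flag : Submodule F L → Prop
  | bot : Flag ⊥
  | step {H : Submodule F L} {α : Γ} {x : L} (hH : Flag H) (hx : g.IsExtension H α x) :
      Flag (H ⊔ F ∙ x)

variable {g}

theorem IsRestrictedSub.bot (hp : p ≠ 0) : g.IsRestrictedSub ⊥ where
  graded := bot_le
  br_mem := by
    intro x hx y hy
    rw [Submodule.mem_bot] at hx
    simp [hx]
  pmap_mem := by
    intro α x _ _ hx
    rw [Submodule.mem_bot] at hx
    simp [hx, g.pmap_zero hp]

theorem IsExtension.br_right_mem {H : Submodule F L} {α : Γ} {x : L} (hx : g.IsExtension H α x)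
    (hH : g.IsRestrictedSub H) {y : L} (hy : y ∈ H) : g.br y x ∈ H := by
  refine hH.homogeneous_induction (P := fun y => g.br y x ∈ H) ?_ (by simp) ?_ hy
  · intro β y hy hyH
    rw [g.skew hx.mem hy]
    exact neg_mem (H.smul_mem _ (hx.br_mem y hyH))
  · intro y z hy hz
    rw [map_add, LinearMap.add_apply]
    exact add_mem hy hz

/-- In any other degree the component of degree `α` would have to vanish. It is the component of
`y`, which lies in the graded subspace `H`, plus `t x`; then `x` would lie in `H`. -/
theorem IsExtension.eq_of_add_smul_mem {H : Submodule F L} {α β : Γ} {x y : L} {t : F}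
    (hx : g.IsExtension H α x) (hH : g.IsRestrictedSub H) (hy : y ∈ H) (ht : t ≠ 0)
    (h : y + t • x ∈ g.comp β) : α = β := by
  by_contra hαβ
  let _ := g.isInternal.chooseDecomposition
  have hcomp : ((DirectSum.decompose g.comp y α : g.comp α) : L) ∈ H := by
    refine hH.homogeneous_induction
      (P := fun z => ((DirectSum.decompose g.comp z α : g.comp α) : L) ∈ H) ?_ (by simp) ?_ hy
    · intro γ z hz hzH
      by_cases h : γ = α
      · subst h; rwa [DirectSum.decompose_of_mem_same _ hz]
      · rw [DirectSum.decompose_of_mem_ne _ hz h]; exact zero_mem H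
    · intro a b ha hb
      rw [DirectSum.decompose_add, DirectSum.add_apply, Submodule.coe_add]
      exact add_mem ha hb
  have h2 : ((DirectSum.decompose g.comp (y + t • x) α : g.comp α) : L) = 0 :=
    DirectSum.decompose_of_mem_ne _ h (Ne.symm hαβ)
  rw [DirectSum.decompose_add, DirectSum.add_apply, Submodule.coe_add,
    DirectSum.decompose_of_mem_same _ ((g.comp α).smul_mem t hx.mem)] at h2
  rw [eq_neg_of_add_eq_zero_left h2] at hcomp
  have h3 := H.smul_mem t⁻¹ (neg_mem hcomp)
  rw [neg_neg, smul_smul, inv_mul_cancel₀ ht, one_smul] at h3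
  exact hx.notMem h3

theorem IsExtension.isRestrictedSub (h2 : (2 : F) ≠ 0) {H : Submodule F L} {α : Γ} {x : L}
    (hx : g.IsExtension H α x) (hH : g.IsRestrictedSub H) : g.IsRestrictedSub (H ⊔ F ∙ x) := by
  have hle : H ≤ H ⊔ F ∙ x := le_sup_left
  have hxm : x ∈ H ⊔ F ∙ x := le_sup_right (a := H) (Submodule.mem_span_singleton_self x)
  have hbr : ∀ u ∈ H ⊔ F ∙ x, ∀ v ∈ H ⊔ F ∙ x, g.br u v ∈ H ⊔ F ∙ x := by
    intro u hu v hv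
    obtain ⟨y, hy, s, rfl⟩ := mem_sup_span_singleton.1 hu
    obtain ⟨z, hz, t, rfl⟩ := mem_sup_span_singleton.1 hv
    refine hle ?_
    have hxx : g.br x x ∈ H := by
      by_cases hα : χ.Even α
      · rw [LieColorAlgebra.br_self_of_even h2 hα hx.mem]; exact zero_mem H
      · exact hx.br_self_mem hα
    simp only [map_add, LinearMap.add_apply, map_smul, LinearMap.smul_apply]
    exact add_mem (add_mem (hH.br_mem y hy z hz) (H.smul_mem _ (hx.br_mem z hz)))
      (H.smul_mem _ (add_mem (hx.br_right_mem hH hy) (H.smul_mem _ hxx)))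
  refine ⟨?_, hbr, ?_⟩
  · refine sup_le (hH.graded.trans (iSup_mono fun β => inf_le_inf_right _ hle)) ?_
    rw [Submodule.span_singleton_le_iff_mem]
    exact Submodule.mem_iSup_of_mem α ⟨hxm, hx.mem⟩
  · intro β u hβ huβ hu
    obtain ⟨y, hy, t, rfl⟩ := mem_sup_span_singleton.1 hu
    by_cases ht : t = 0
    · subst ht
      rw [zero_smul, add_zero] at huβ ⊢
      exact hle (hH.pmap_mem β y hβ huβ hy)
    by_cases hαβ : α = β
    · subst hαβ
      have htx := (g.comp α).smul_mem t hx.mem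
      have hyα : y ∈ g.comp α := by simpa using sub_mem huβ htx
      rw [g.pmap_add hβ hyα htx, g.pmap_smul t hβ hx.mem]
      refine add_mem (add_mem (hle (hH.pmap_mem α y hβ hyα hy))
        (hle (H.smul_mem _ (hx.pmap_mem hβ)))) (sum_mem fun i _ => Submodule.smul_mem _ _ ?_)
      exact LieColorAlgebra.adCoeff_mem_of_closed hbr (hle hy) (Submodule.smul_mem _ t hxm) _ _
    · exact absurd (hx.eq_of_add_smul_mem hH hy ht huβ) hαβ

theorem Flag.isRestrictedSub (hp : p ≠ 0) (h2 : (2 : F) ≠ 0) {H : Submodule F L} (hH : g.Flag H) :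
    g.IsRestrictedSub H := by
  induction hH with
  | bot => exact IsRestrictedSub.bot hp
  | step _ hx ih => exact hx.isRestrictedSub h2 ih

theorem exists_homogeneous_notMem {H : Submodule F L} (hH : H ≠ ⊤) : ∃ α, ∃ x ∈ g.comp α, x ∉ H := by
  by_contra! h
  exact hH (top_le_iff.1 (g.iSup_comp ▸ iSup_le fun α x hx => h α x hx))

/-- Engel's argument: a flag acts on the quotient by a larger proper subalgebra with a common
homogeneous null vector. -/
theorem Flag.exists_normalizing (hp : p ≠ 0) (h2 : (2 : F) ≠ 0) (hg : g.IsUnipotent)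
    {H : Submodule F L} (hH : g.IsRestrictedSub H) (hHt : H ≠ ⊤) {K : Submodule F L}
    (hK : g.Flag K) (hKH : K ≤ H) :
    ∃ α, ∃ v ∈ g.comp α, v ∉ H ∧ ∀ y ∈ K, g.br y v ∈ H := by
  induction hK with
  | bot =>
    obtain ⟨α, v, hv, hvH⟩ := exists_homogeneous_notMem (g := g) hHt
    refine ⟨α, v, hv, hvH, fun y hy => ?_⟩
    rw [Submodule.mem_bot] at hy
    simp [hy]
  | @step K β x hK hx ih =>
    obtain ⟨α, v, hv, hvH, hKv⟩ := ih (le_sup_left.trans hKH)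
    have hxH : x ∈ H := hKH (le_sup_right (a := K) (Submodule.mem_span_singleton_self x))
    have hKs := hK.isRestrictedSub hp h2
    obtain ⟨N, hN⟩ := hg.exists_br_iterate_eq_zero h2 hx.mem
    have hmem (j : ℕ) : (g.br x)^[j] v ∈ g.comp (j • β + α) := by
      induction j with
      | zero => simpa using hv
      | succ j ih =>
        rw [Function.iterate_succ_apply', succ_nsmul', add_assoc]
        exact g.br_mem hx.mem ih
    -- The condition `[K, w] ⊆ H` passes from `w` to `[x, w]`: in `[y,[x,w]] = [[y,x],w] ±
    -- …[x,[y,w]]`, up to a scalar, `[y,x]` lies in `K`, while `[y,w]` and `x` lie in `H`. As `ad x`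
    -- is nilpotent, the last iterate outside `H` works for all of `K + F x`.
    have hKj (j : ℕ) : ∀ y ∈ K, g.br y ((g.br x)^[j] v) ∈ H := by
      induction j with
      | zero => exact hKv
      | succ j ih =>
        intro y hy
        refine hKs.homogeneous_induction (P := fun y => g.br y ((g.br x)^[j + 1] v) ∈ H) ?_
          (by simp) ?_ hy
        · intro γ y hy hyK
          rw [Function.iterate_succ_apply', LieColorAlgebra.br_br hy hx.mem (hmem j)]
          exact add_mem (ih _ (hx.br_right_mem hKs hyK))
            (H.smul_mem _ (hH.br_mem x hxH _ (ih y hyK)))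
        · intro y z hy hz
          rw [map_add, LinearMap.add_apply]
          exact add_mem hy hz
    classical
    have hex : ∃ j, (g.br x)^[j] v ∈ H := ⟨N, by rw [hN]; exact zero_mem H⟩
    obtain ⟨m, hm⟩ : ∃ m, Nat.find hex = m + 1 := by
      refine Nat.exists_eq_succ_of_ne_zero fun h => ?_
      have := Nat.find_spec hex
      rw [h] at this
      exact hvH this
    refine ⟨_, _, hmem m, Nat.find_min hex (by omega), fun y hy => ?_⟩
    obtain ⟨z, hz, t, rfl⟩ := mem_sup_span_singleton.1 hy
    rw [map_add, LinearMap.add_apply, map_smul, LinearMap.smul_apply]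
    refine add_mem (hKj m z hz) (H.smul_mem _ ?_)
    have := Nat.find_spec hex
    rwa [hm, Function.iterate_succ_apply'] at this

/-- Engel's argument with `K = H` gives a homogeneous `v` outside `H` that normalizes `H`. If `v` is
even, it is replaced by its last iterated `p`-power outside `H`. If `v` is odd, either `[v,v]` lies
in `H` and `v` itself serves, or `[v,v]` is an even normalizing element outside `H`. -/
theorem Flag.exists_extension (hp : p ≠ 0) (h2 : (2 : F) ≠ 0) (hg : g.IsUnipotent)
    {H : Submodule F L} (hH : g.Flag H) (hHt : H ≠ ⊤) : ∃ α x, g.IsExtension H α x := by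
  have hHs := hH.isRestrictedSub hp h2
  obtain ⟨α, v, hv, hvH, hnorm⟩ := hH.exists_normalizing hp h2 hg hHs hHt le_rfl
  have hnorm' : ∀ y ∈ H, g.br v y ∈ H := by
    intro y hy
    refine hHs.homogeneous_induction (P := fun y => g.br v y ∈ H) ?_ (by simp) ?_ hy
    · intro β y hy hyH
      rw [g.skew hy hv]
      exact neg_mem (H.smul_mem _ (hnorm y hyH))
    · intro y z hy hz
      rw [map_add]
      exact add_mem hy hz
  have even_case : ∀ (β : Γ) (w : L), χ.Even β → w ∈ g.comp β → w ∉ H → (∀ y ∈ H, g.br w y ∈ H) →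
      ∃ α x, g.IsExtension H α x := by
    intro β w hβ hw hwH hnw
    obtain ⟨n, -, hn⟩ := hg β w hβ hw
    classical
    have hex : ∃ j, g.pmap^[j] w ∈ H := ⟨n, by rw [hn]; exact zero_mem H⟩
    obtain ⟨m, hm⟩ : ∃ m, Nat.find hex = m + 1 := by
      refine Nat.exists_eq_succ_of_ne_zero fun h => ?_
      have := Nat.find_spec hex
      rw [h] at this
      exact hwH this
    refine ⟨_, _, g.pmap_iterate_mem hβ hw m, Nat.find_min hex (by omega), ?_, ?_, ?_⟩
    · intro y hy
      rw [← g.br_iterate_pow hβ hw]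
      generalize p ^ m = k
      induction k with
      | zero => exact hy
      | succ k ih => rw [Function.iterate_succ_apply']; exact hnw _ ih
    · intro _
      have := Nat.find_spec hex
      rwa [hm, Function.iterate_succ_apply'] at this
    · exact fun h => absurd (hβ.nsmul _) h
  by_cases hα : χ.Even α
  · exact even_case α v hα hv hvH hnorm'
  · by_cases hvv : g.br v v ∈ H
    · exact ⟨α, v, hv, hvH, hnorm', fun h => absurd h hα, fun _ => hvv⟩
    · refine even_case _ _ (χ.even_add_self α) (g.br_mem hv hv) hvv fun y hy => ?_
      rw [LieColorAlgebra.br_br_self' hα hv]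
      exact H.smul_mem _ (hnorm' _ (hnorm' _ hy))

/-- A maximal member among the flag subspaces must be everything, since a proper one can be
extended. -/
theorem flag_top [FiniteDimensional F L] (hp : p ≠ 0) (h2 : (2 : F) ≠ 0) (hg : g.IsUnipotent) :
    g.Flag ⊤ := by
  obtain ⟨H, hH, hmax⟩ := (wellFounded_gt (α := Submodule F L)).has_min {H | g.Flag H}
    ⟨⊥, Flag.bot⟩
  by_cases hHt : H = ⊤
  · rwa [← hHt]
  · obtain ⟨α, x, hx⟩ := hH.exists_extension hp h2 hg hHt
    refine absurd (lt_of_le_of_ne le_sup_left fun h => hx.notMem ?_) (hmax _ (Flag.step hH hx))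
    rw [h]
    exact le_sup_right (a := H) (Submodule.mem_span_singleton_self x)

/-- A nonzero finite-dimensional unipotent restricted Lie color algebra has a restricted graded
ideal of codimension one with a homogeneous complement. -/
theorem exists_codim_one [FiniteDimensional F L] [Nontrivial L] (hp : p ≠ 0) (h2 : (2 : F) ≠ 0)
    (hg : g.IsUnipotent) :
    ∃ (H : Submodule F L) (α : Γ) (x : L), g.IsRestrictedSub H ∧ g.IsExtension H α x ∧
      H ⊔ F ∙ x = ⊤ := by
  have h := flag_top hp h2 hg
  generalize hT : (⊤ : Submodule F L) = T at h
  cases h with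
  | bot => exact absurd hT top_ne_bot
  | step hH hx => exact ⟨_, _, _, hH.isRestrictedSub hp h2, hx, rfl⟩

end RestrictedLieColorAlgebra

/-! ### The module `A[t; σ, δ] / (t^(k+1) - c)` -/

section OreModule

variable {F A : Type*} [Field F] [Ring A] [Algebra F A]

/-- Left multiplication by `t` on `A[t; σ, δ] / (t ^ (k + 1) - c)`, in terms of the basis
`1, t, …, t ^ k` of this quotient as a left `A`-module. -/
noncomputable def oreShift (σ δ : A →ₗ[F] A) (c : A) (k : ℕ) : Module.End F (Fin (k + 1) → A) where
  -- This is the rule `t · a t^i = σ(a) t^(i+1) + δ(a) t^i`, with `t^(k+1)` wrapped around to `c` in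
  -- position 0.
  toFun f := Fin.cons (δ (f 0) + σ (f (Fin.last k)) * c)
    fun i : Fin k => δ (f i.succ) + σ (f i.castSucc)
  map_add' f f' := by
    ext i
    refine Fin.cases ?_ (fun i => ?_) i
    · simp only [Fin.cons_zero, Pi.add_apply, map_add, add_mul]; abel
    · simp only [Fin.cons_succ, Pi.add_apply, map_add]; abel
  map_smul' r f := by
    ext i
    refine Fin.cases ?_ (fun i => ?_) i
    · simp
    · simp

variable (σ δ : A →ₗ[F] A) (c : A) (k : ℕ)

theorem oreShift_zero (f : Fin (k + 1) → A) :
    oreShift σ δ c k f 0 = δ (f 0) + σ (f (Fin.last k)) * c := rfl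

theorem oreShift_succ (f : Fin (k + 1) → A) (i : Fin k) :
    oreShift σ δ c k f i.succ = δ (f i.succ) + σ (f i.castSucc) := rfl

variable (hσ : ∀ a b, σ (a * b) = σ a * σ b) (hσ1 : σ 1 = 1)
  (hδ : ∀ a b, δ (a * b) = δ a * b + σ a * δ b)
include hσ hδ

theorem oreShift_mul_lsmul (a : A) :
    oreShift σ δ c k * Algebra.lsmul F F (Fin (k + 1) → A) a =
      Algebra.lsmul F F (Fin (k + 1) → A) (σ a) * oreShift σ δ c k +
        Algebra.lsmul F F (Fin (k + 1) → A) (δ a) := by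
  refine LinearMap.ext fun f => funext fun i => ?_
  simp only [Module.End.mul_apply, LinearMap.add_apply, Algebra.lsmul_coe, Pi.add_apply,
    Pi.smul_apply, smul_eq_mul]
  refine Fin.cases ?_ (fun i => ?_) i
  · simp only [oreShift_zero, Pi.smul_apply, smul_eq_mul, hσ, hδ, mul_add, mul_assoc]
    abel
  · simp only [oreShift_succ, Pi.smul_apply, smul_eq_mul, hσ, hδ, mul_add]
    abel

include hσ1

omit hσ in
theorem derivation_one : δ 1 = 0 := by
  have h := hδ 1 1
  rwa [mul_one, mul_one, hσ1, one_mul, left_eq_add] at h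

omit hσ hδ in
theorem oreShift_single_castSucc (hδ1 : δ 1 = 0) (i : Fin k) :
    oreShift σ δ c k (Pi.single i.castSucc 1) = Pi.single i.succ 1 := by
  funext j
  refine Fin.cases ?_ (fun j => ?_) j
  · rw [oreShift_zero, Pi.single_eq_of_ne (Fin.succ_ne_zero i).symm,
      Pi.single_eq_of_ne (i' := Fin.last k) (Fin.castSucc_lt_last i).ne', map_zero, zero_mul, add_zero]
    by_cases h : i.castSucc = 0
    · rw [h, Pi.single_eq_same, hδ1]
    · rw [Pi.single_eq_of_ne (Ne.symm h), map_zero]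
  · rw [oreShift_succ]
    have h1 : δ ((Pi.single i.castSucc (1 : A) : Fin (k + 1) → A) j.succ) = 0 := by
      by_cases h : j.succ = i.castSucc
      · rw [h, Pi.single_eq_same, hδ1]
      · rw [Pi.single_eq_of_ne h, map_zero]
    rw [h1, zero_add]
    by_cases h : j = i
    · subst h; rw [Pi.single_eq_same, Pi.single_eq_same, hσ1]
    · rw [Pi.single_eq_of_ne (by simpa using h), Pi.single_eq_of_ne (by simpa using h), map_zero]

-- The vector `1` generates: its images under powers of `t` run through the basis. The lower bound
-- on the dimension of `u(g)` rests on this.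
omit hσ in
theorem oreShift_pow_single_zero (i : Fin (k + 1)) :
    (oreShift σ δ c k ^ (i : ℕ)) (Pi.single 0 1) = Pi.single i 1 := by
  have hδ1 := derivation_one σ δ hσ1 hδ
  induction i using Fin.induction with
  | zero => simp
  | succ i ih =>
    rw [Fin.val_succ, pow_succ', Module.End.mul_apply]
    rw [Fin.val_castSucc] at ih
    rw [ih, oreShift_single_castSucc σ δ c k hσ1 hδ1]

/-- On the vector `1` the relation holds by construction. It spreads to each `t^i` because `t`
commutes with `c`, and to `a t^i` because `t^(k+1) a = σ^(k+1)(a) t^(k+1) + δ^(k+1)(a)` by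
`pow_mul_twisted`, where `hδk` identifies the result with `c a`. -/
theorem oreShift_pow (hσc : σ c = c) (hδc : δ c = 0)
    (hk : ((k + 1).Prime ∧ ((k + 1 : ℕ) : F) = 0 ∧ ∀ a, σ (δ a) = δ (σ a)) ∨
      (k + 1 = 2 ∧ ∀ a, σ (δ a) = -δ (σ a)))
    (hδk : ∀ a, δ^[k + 1] a = c * a - σ^[k + 1] a * c) :
    oreShift σ δ c k ^ (k + 1) = Algebra.lsmul F F (Fin (k + 1) → A) c := by
  set X := oreShift σ δ c k with hX
  set l : A →ₐ[F] Module.End F (Fin (k + 1) → A) := Algebra.lsmul F F (Fin (k + 1) → A) with hl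
  have hla (a : A) (f : Fin (k + 1) → A) (i) : l a f i = a * f i := rfl
  have hδ1 := derivation_one σ δ hσ1 hδ
  have hlast : X (Pi.single (Fin.last k) 1) = l c (Pi.single 0 1) := by
    funext j
    refine Fin.cases ?_ (fun j => ?_) j
    · have : δ ((Pi.single (Fin.last k) (1 : A) : Fin (k + 1) → A) 0) = 0 := by
        by_cases h : 0 = Fin.last k
        · rw [h, Pi.single_eq_same, hδ1]
        · rw [Pi.single_eq_of_ne h, map_zero]
      rw [hX, oreShift_zero, Pi.single_eq_same, hσ1, one_mul, this, hla, Pi.single_eq_same,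
        mul_one, zero_add]
    · rw [hX, oreShift_succ, Pi.single_eq_of_ne (i' := j.castSucc) (Fin.castSucc_lt_last j).ne, map_zero,
        add_zero, hla, Pi.single_eq_of_ne (Fin.succ_ne_zero j), mul_zero]
      by_cases h : j.succ = Fin.last k
      · rw [h, Pi.single_eq_same, hδ1]
      · rw [Pi.single_eq_of_ne h, map_zero]
  have hXl (a : A) : X * l a = l (σ a) * X + l (δ a) := oreShift_mul_lsmul σ δ c k hσ hδ a
  have hcomm : Commute X (l c) := by
    have h := hXl c
    rwa [hσc, hδc, map_zero, add_zero] at h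
  have hsingle (i : Fin (k + 1)) : (X ^ (k + 1)) (Pi.single i 1) = l c (Pi.single i 1) := by
    rw [← oreShift_pow_single_zero σ δ c k hσ1 hδ i, ← Module.End.mul_apply,
      ← Module.End.mul_apply, ((Commute.refl X).pow_pow (k + 1) i).eq, ← (hcomm.pow_left i).eq,
      Module.End.mul_apply, Module.End.mul_apply]
    congr 1
    rw [pow_succ', Module.End.mul_apply]
    have h := oreShift_pow_single_zero σ δ c k hσ1 hδ (Fin.last k)
    rw [Fin.val_last] at h
    rw [h, hlast]
  refine LinearMap.ext fun f => ?_
  have hf : f = ∑ i, l (f i) (Pi.single i 1) := by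
    funext j
    rw [Finset.sum_apply]
    simp only [hla, Pi.single_apply, mul_ite, mul_one,
      mul_zero, Finset.sum_ite_eq, Finset.mem_univ, if_true]
  rw [hf, map_sum, map_sum]
  refine Finset.sum_congr rfl fun i _ => ?_
  have h := pow_mul_twisted l.toLinearMap σ δ X hXl (k + 1) hk (f i)
  simp only [AlgHom.toLinearMap_apply] at h
  rw [← Module.End.mul_apply, h, LinearMap.add_apply, Module.End.mul_apply, hsingle,
    ← Module.End.mul_apply, ← map_mul, ← LinearMap.add_apply, ← map_add, hδk, add_sub_cancel,
    map_mul, Module.End.mul_apply]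

end OreModule

/-! ### Extending color derivations of `g` to `u(g)` -/

namespace RestrictedLieColorAlgebra

variable {F : Type*} [Field F] {p : ℕ} {Γ : Type*} [AddCommGroup Γ] [DecidableEq Γ]
  {χ : Bicharacter F Γ} {L : Type*} [AddCommGroup L] [Module F L]
  (g : RestrictedLieColorAlgebra p χ L)

/-- The automorphism of `u(g)` acting on the component of degree `β` by `(α, β)`. -/
noncomputable def uTwist (α : Γ) : g.RestrictedEnveloping →ₐ[F] g.RestrictedEnveloping :=
  g.lift (g.uι ∘ₗ g.twist α)
    (by
      intro β γ x y hx hy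
      simp only [LinearMap.comp_apply, g.twist_apply α hx, g.twist_apply α hy,
        g.twist_apply α (g.br_mem hx hy), map_smul, ← g.uι_mul hx hy, smul_mul_smul_comm, smul_sub,
        χ.add_right, Units.val_mul]
      rw [mul_comm (χ.toFun α γ : F), smul_comm])
    (by
      intro β x hβ hx
      rw [LinearMap.comp_apply, LinearMap.comp_apply, g.twist_apply α hx,
        g.twist_apply α (g.pmap_mem hβ hx), map_smul, map_smul, smul_pow, g.uι_pow hβ hx,
        χ.toFun_nsmul_right, Units.val_pow_eq_pow_val])

theorem uTwist_uι (α : Γ) {β : Γ} {x : L} (hx : x ∈ g.comp β) :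
    g.uTwist α (g.uι x) = (χ.toFun α β : F) • g.uι x := by
  rw [uTwist, lift_uι, LinearMap.comp_apply, g.twist_apply α hx, map_smul]

/-- A homogeneous color derivation of degree `α`, compatible with the `p`-map. -/
structure IsColorDerivation (α : Γ) (D : L →ₗ[F] L) : Prop where
  mem : ∀ {β x}, x ∈ g.comp β → D x ∈ g.comp (α + β)
  br : ∀ {β γ x y}, x ∈ g.comp β → y ∈ g.comp γ →
    D (g.br x y) = g.br (D x) y + (χ.toFun α β : F) • g.br x (D y)
  pmap : ∀ {β x}, χ.Even β → x ∈ g.comp β →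
    D (g.pmap x) = (χ.toFun α β : F) ^ (p - 1) • (g.br x)^[p - 1] (D x)

theorem upperTriangular_pow {A : Type*} [Ring A] (a b d : A) (n : ℕ) :
    (!![a, b; 0, d] : Matrix (Fin 2) (Fin 2) A) ^ n =
      !![a ^ n, ∑ i ∈ Finset.range n, a ^ i * b * d ^ (n - 1 - i); 0, d ^ n] := by
  induction n with
  | zero => simp [Matrix.one_fin_two]
  | succ n ih =>
    rw [pow_succ', ih, Matrix.mul_fin_two, Finset.sum_range_succ']
    simp only [mul_zero, add_zero, zero_mul, Finset.sum_const_zero, zero_add, ← pow_succ', Finset.mul_sum, pow_zero, one_mul,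
      Nat.sub_zero, Nat.add_sub_cancel]
    congr 5
    refine Finset.sum_congr rfl fun i _ => ?_
    rw [pow_succ', mul_assoc, mul_assoc, mul_assoc, Nat.sub_sub, add_comm 1 i]

variable {g}

/-- Since `β` is even, `(β, mβ + α) = (β, α)`: the scalar twisting the commutator is the same at
every iteration, so `ad y` is the restriction of one fixed operator. -/
theorem uι_br_iterate {α β : Γ} (hβ : χ.Even β) {y z : L} (hy : y ∈ g.comp β) (hz : z ∈ g.comp α)
    (m : ℕ) : g.uι ((g.br y)^[m] z) = ((LinearMap.mulLeft F (g.uι y) -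
      (χ.toFun β α : F) • LinearMap.mulRight F (g.uι y)) ^ m) (g.uι z) := by
  have hmem (m : ℕ) : (g.br y)^[m] z ∈ g.comp (m • β + α) := by
    induction m with
    | zero => simpa using hz
    | succ m ih =>
      rw [Function.iterate_succ_apply', succ_nsmul', add_assoc]
      exact g.br_mem hy ih
  induction m with
  | zero => rfl
  | succ m ih =>
    rw [Function.iterate_succ_apply', ← g.uι_mul hy (hmem m), ih, pow_succ', Module.End.mul_apply,
      LinearMap.sub_apply, LinearMap.smul_apply, LinearMap.mulLeft_apply, LinearMap.mulRight_apply,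
      χ.add_right, χ.toFun_nsmul_right, hβ, one_pow, one_mul]

/-- The right side is the twisted Leibniz expansion of `D` on `y^p`, which is also the upper right
entry of the `p`-th power of a triangular matrix. It is what makes `matrixHom` respect the relation
`y^p = y^[p]`. -/
theorem IsColorDerivation.uι_pmap {α β : Γ} {D : L →ₗ[F] L} (hD : g.IsColorDerivation α D)
    (hp : p.Prime) (hodd : Odd p) (hpF : (p : F) = 0) (hβ : χ.Even β) {y : L} (hy : y ∈ g.comp β) :
    g.uι (D (g.pmap y)) = ∑ i ∈ Finset.range p,
      ((χ.toFun α β : F) • g.uι y) ^ i * g.uι (D y) * g.uι y ^ (p - 1 - i) := by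
  rw [hD.pmap hβ hy, map_smul, uι_br_iterate hβ hy (hD.mem hy), Commute.sub_pow_prime_pred hp hodd,
    LinearMap.sum_apply, Finset.smul_sum]
  · refine Finset.sum_congr rfl fun i hi => ?_
    have hi' := Finset.mem_range.1 hi
    rw [smul_pow, smul_pow, Module.End.mul_apply, LinearMap.smul_apply, map_smul, smul_smul,
      LinearMap.pow_mulLeft, LinearMap.pow_mulRight, LinearMap.mulLeft_apply,
      LinearMap.mulRight_apply, smul_mul_assoc, smul_mul_assoc, mul_assoc]
    congr 1
    rw [χ.add_right, hβ, mul_one]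
    obtain ⟨m, hm⟩ : ∃ m, p - 1 = i + m := ⟨p - 1 - i, by omega⟩
    rw [hm, Nat.add_sub_cancel_left, pow_add, mul_assoc, ← mul_pow, χ.val_mul_swap, one_pow, mul_one]
  · rw [← map_natCast (algebraMap F (Module.End F g.RestrictedEnveloping)), hpF, map_zero]
  · exact (LinearMap.commute_mulLeft_right (R := F) _ _).smul_right _

/-- The algebra map `a ↦ [[σ a, δ a], [0, a]]` encoding the extension of a color derivation to
`u(g)`. -/
noncomputable def IsColorDerivation.matrixHom {α : Γ} {D : L →ₗ[F] L}
    (hD : g.IsColorDerivation α D) (hp : p.Prime) (hodd : Odd p) (hpF : (p : F) = 0) :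
    g.RestrictedEnveloping →ₐ[F] Matrix (Fin 2) (Fin 2) g.RestrictedEnveloping :=
  g.lift
    { toFun := fun y => !![g.uι (g.twist α y), g.uι (D y); 0, g.uι y]
      map_add' := fun y z => by ext i j; fin_cases i <;> fin_cases j <;> simp
      map_smul' := fun r y => by ext i j; fin_cases i <;> fin_cases j <;> simp }
    (by
      intro β γ y z hy hz
      have h1 := g.uι_mul (hD.mem hy) hz
      have h2 := g.uι_mul hy (hD.mem hz)
      have h3 := g.uι_mul hy hz
      simp only [LinearMap.coe_mk, AddHom.coe_mk, Matrix.mul_fin_two, g.twist_apply α hy,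
        g.twist_apply α hz, g.twist_apply α (g.br_mem hy hz), hD.br hy hz, map_add, map_smul, ← h1,
        ← h2, ← h3, χ.add_left, χ.add_right, Units.val_mul, mul_zero, zero_mul, add_zero, zero_add]
      have hs := χ.val_mul_swap α β
      have hcancel (a : g.RestrictedEnveloping) :
          (χ.toFun α β : F) • ((χ.toFun β α : F) * (χ.toFun β γ : F)) • a
            = (χ.toFun β γ : F) • a := by
        rw [smul_smul, ← mul_assoc, hs, one_mul]
      ext i j
      fin_cases i <;> fin_cases j
      · simp only [Fin.zero_eta, Fin.isValue, Matrix.sub_apply, Matrix.smul_apply, Matrix.of_apply,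
          Matrix.cons_val', Matrix.cons_val_zero, Matrix.cons_val_fin_one, smul_mul_smul_comm,
          smul_sub]
        rw [mul_comm (χ.toFun α γ : F), smul_comm]
      · simp only [Fin.zero_eta, Fin.isValue, Fin.mk_one, Matrix.sub_apply, Matrix.smul_apply,
          Matrix.of_apply, Matrix.cons_val', Matrix.cons_val_zero, Matrix.cons_val_one,
          Matrix.cons_val_fin_one, smul_add, smul_sub, hcancel, smul_mul_assoc]
        rw [smul_smul (χ.toFun β γ : F), mul_comm (χ.toFun β γ : F)]
        abel
      · simp
      · simp)
    (by
      intro β y hβ hy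
      simp only [LinearMap.coe_mk, AddHom.coe_mk, upperTriangular_pow, g.twist_apply α hy,
        g.twist_apply α (g.pmap_mem hβ hy), map_smul, smul_pow, g.uι_pow hβ hy,
        hD.uι_pmap hp hodd hpF hβ hy, χ.toFun_nsmul_right, Units.val_pow_eq_pow_val])

section Deriv

variable {α : Γ} {D : L →ₗ[F] L} (hD : g.IsColorDerivation α D) (hp : p.Prime) (hodd : Odd p)
  (hpF : (p : F) = 0)

/-- The extension of a color derivation of `g` to a twisted derivation of `u(g)`. -/
noncomputable def IsColorDerivation.uDeriv : g.RestrictedEnveloping →ₗ[F] g.RestrictedEnveloping :=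
  Matrix.entryLinearMap F _ 0 1 ∘ₗ (hD.matrixHom hp hodd hpF).toLinearMap

theorem IsColorDerivation.matrixHom_apply (a : g.RestrictedEnveloping) :
    hD.matrixHom hp hodd hpF a = !![g.uTwist α a, hD.uDeriv hp hodd hpF a; 0, a] := by
  suffices h : hD.matrixHom hp hodd hpF a 0 0 = g.uTwist α a ∧ hD.matrixHom hp hodd hpF a 1 0 = 0 ∧
      hD.matrixHom hp hodd hpF a 1 1 = a by
    ext i j
    fin_cases i <;> fin_cases j
    · simpa using h.1
    · rfl
    · simpa using h.2.1
    · simpa using h.2.2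
  induction a using g.enveloping_induction with
  | one => simp
  | add a b ha hb => simp [ha, hb]
  | smul r a ha => simp [ha]
  | mul β x a hx ha =>
    have : hD.matrixHom hp hodd hpF (g.uι x) = !![g.uι (g.twist α x), g.uι (D x); 0, g.uι x] :=
      lift_uι ..
    rw [map_mul, map_mul, this, g.uTwist_uι α hx, g.twist_apply α hx]
    simp [Matrix.mul_apply, ha]

theorem IsColorDerivation.uDeriv_uι (x : L) : hD.uDeriv hp hodd hpF (g.uι x) = g.uι (D x) := by
  have : hD.matrixHom hp hodd hpF (g.uι x) = !![g.uι (g.twist α x), g.uι (D x); 0, g.uι x] :=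
    lift_uι ..
  simp [uDeriv, this]

theorem IsColorDerivation.uDeriv_mul (a b : g.RestrictedEnveloping) :
    hD.uDeriv hp hodd hpF (a * b) =
      hD.uDeriv hp hodd hpF a * b + g.uTwist α a * hD.uDeriv hp hodd hpF b := by
  have h := congrFun (congrFun (map_mul (hD.matrixHom hp hodd hpF) a b) 0) 1
  rw [hD.matrixHom_apply, hD.matrixHom_apply, hD.matrixHom_apply, Matrix.mul_fin_two] at h
  simpa [add_comm] using h

/-- Twist and derivation thus commute when `α` is even and anticommute when it is odd, which are the
two cases of `pow_mul_twisted`. -/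
theorem IsColorDerivation.uTwist_uDeriv (a : g.RestrictedEnveloping) :
    g.uTwist α (hD.uDeriv hp hodd hpF a) =
      (χ.toFun α α : F) • hD.uDeriv hp hodd hpF (g.uTwist α a) := by
  have h1 : hD.uDeriv hp hodd hpF 1 = 0 :=
    derivation_one (g.uTwist α).toLinearMap _ (map_one (g.uTwist α))
      (hD.uDeriv_mul hp hodd hpF)
  induction a using g.enveloping_induction with
  | one => rw [map_one (g.uTwist α), h1, map_zero, smul_zero]
  | add a b ha hb => simp only [map_add, ha, hb, smul_add]
  | smul r a ha => rw [map_smul, map_smul, ha, map_smul, map_smul, smul_comm]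
  | mul β x a hx ha =>
    rw [hD.uDeriv_mul, map_add, map_mul, map_mul, map_mul, hD.uDeriv_mul, ha, hD.uDeriv_uι,
      g.uTwist_uι α (hD.mem hx), g.uTwist_uι α hx, map_smul, map_smul, hD.uDeriv_uι,
      g.uTwist_uι α hx, χ.add_right, Units.val_mul]
    simp only [smul_add, smul_mul_assoc, mul_smul_comm, smul_smul]

end Deriv

end RestrictedLieColorAlgebra

/-! ### Adjoining one element: `u(g)` acts on a free `u(H)`-module of rank `k + 1` -/

theorem mul_self_sub_neg_one_smul {F R : Type*} [Field F] [Ring R] [Algebra F R] (X : R) :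
    X * X - (-1 : F) • (X * X) = (2 : F) • X ^ 2 := by
  rw [neg_smul, one_smul, sub_neg_eq_add, two_smul, sq]

namespace RestrictedLieColorAlgebra

variable {F : Type*} [Field F] {p : ℕ} {Γ : Type*} [AddCommGroup Γ] [DecidableEq Γ]
  {χ : Bicharacter F Γ} {L : Type*} [AddCommGroup L] [Module F L]
  {g : RestrictedLieColorAlgebra p χ L}

/-- Compatibility with the `p`-map: `[x, y^[p]] = -(α,β)^p (ad y)^(p-1) [y,x]`, and turning `[y,x]`
into `[x,y]` cancels the sign and one factor `(α,β)`. -/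
theorem IsExtension.isColorDerivation (hp : p ≠ 0) {H : Submodule F L} {α : Γ} {x : L}
    (hx : g.IsExtension H α x) (hH : g.IsRestrictedSub H) :
    hH.toAlgebra.IsColorDerivation α ((g.br x).restrict hx.br_mem) where
  mem hy := g.br_mem hx.mem hy
  br hy hz := Subtype.ext (LieColorAlgebra.br_br hx.mem hy hz)
  pmap {β y} hβ hy := by
    have hy : (y : L) ∈ g.comp β := hy
    refine Subtype.ext ?_
    change g.br x (hH.toAlgebra.pmap y) = (χ.toFun α β : F) ^ (p - 1) •
      ((hH.toLieColorAlgebra.br y)^[p - 1] ((g.br x).restrict hx.br_mem y) : L)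
    rw [hH.coe_br_iterate, LinearMap.coe_restrict_apply, hH.coe_pmap hβ hy,
      g.skew (g.pmap_mem hβ hy) hx.mem, g.br_pmap hβ hy]
    have hit (z : L) : (g.br y)^[p] z = (g.br y)^[p - 1] (g.br y z) := by
      rw [← Function.iterate_succ_apply, Nat.succ_eq_add_one, Nat.sub_add_cancel (by omega)]
    have hχ : (χ.toFun α β : F) ^ p = (χ.toFun α β : F) ^ (p - 1) * χ.toFun α β := by
      rw [← pow_succ, Nat.sub_add_cancel (by omega)]
    rw [hit, g.skew hx.mem hy, ← Module.End.coe_pow, map_neg, map_smul, smul_neg, neg_neg, smul_smul,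
      χ.toFun_nsmul_right, Units.val_pow_eq_pow_val, hχ, mul_assoc, χ.val_mul_swap, mul_one]

variable {H : Submodule F L} {α : Γ} {x : L}

theorem IsExtension.exists_projection (hx : g.IsExtension H α x) (htop : H ⊔ F ∙ x = ⊤) :
    ∃ (π : L →ₗ[F] H) (f : L →ₗ[F] F), (∀ y : H, π y = y ∧ f y = 0) ∧ π x = 0 ∧ f x = 1 := by
  have hc : IsCompl H (F ∙ x) := by
    refine ⟨?_, codisjoint_iff.2 htop⟩
    have hx0 : x ≠ 0 := fun h => hx.notMem (by rw [h]; exact zero_mem H)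
    rw [Submodule.disjoint_span_singleton' hx0]
    exact hx.notMem
  obtain ⟨f, hfx, hfH⟩ := Submodule.exists_dual_map_eq_bot_of_notMem hx.notMem inferInstance
  have hf : ∀ y ∈ H, f y = 0 := by
    intro y hy
    have : f y ∈ H.map f := Submodule.mem_map_of_mem hy
    rwa [hfH, Submodule.mem_bot] at this
  refine ⟨H.projectionOnto (F ∙ x) hc, (f x)⁻¹ • f, fun y => ⟨?_, ?_⟩, ?_, ?_⟩
  · simp
  · simp [hf y y.2]
  · simp [Submodule.mem_span_singleton_self]
  · simp [hfx]

/-- `H` acts by left multiplication and `x` by the Ore shift. The relations of `u(g)` between `H`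
and `x` are the Ore commutation rule, and those of `x` with itself come from `t^(k+1) = c`. -/
theorem IsExtension.exists_representation (hp : p.Prime) (hodd : Odd p)
    (hF : ∀ i : ℕ, (i : F) = 0 ↔ p ∣ i) (hH : g.IsRestrictedSub H) (hx : g.IsExtension H α x)
    (htop : H ⊔ F ∙ x = ⊤) {k : ℕ} (c : H) (hc : (c : L) ∈ g.comp ((k + 1) • α))
    (hxc : g.br x c = 0) (hbrc : ∀ y, (g.br x)^[k + 1] y = g.br c y)
    (hk : (k + 1 = p ∧ χ.Even α ∧ g.pmap x = c) ∨
      (k + 1 = 2 ∧ ¬ χ.Even α ∧ g.br x x = (2 : F) • (c : L))) :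
    ∃ (ρ : g.RestrictedEnveloping →ₐ[F]
        Module.End F (Fin (k + 1) → hH.toAlgebra.RestrictedEnveloping))
      (δ : hH.toAlgebra.RestrictedEnveloping →ₗ[F] hH.toAlgebra.RestrictedEnveloping),
      (∀ a b, δ (a * b) = δ a * b + hH.toAlgebra.uTwist α a * δ b) ∧
      (∀ y : H, ρ (g.uι y) = Algebra.lsmul F F _ (hH.toAlgebra.uι y)) ∧
      ρ (g.uι x) = oreShift (hH.toAlgebra.uTwist α).toLinearMap δ (hH.toAlgebra.uι c) k := by
  set g' := hH.toAlgebra with hg'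
  have hpF : (p : F) = 0 := (hF p).2 dvd_rfl
  have hD := hx.isColorDerivation hp.ne_zero hH
  set D := (g.br x).restrict hx.br_mem with hDdef
  set σ := g'.uTwist α with hσdef
  set δ := hD.uDeriv hp hodd hpF with hδdef
  set c' := g'.uι c with hc'
  have hδ : ∀ a b, δ (a * b) = δ a * b + σ a * δ b := hD.uDeriv_mul hp hodd hpF
  have hδι : ∀ y, δ (g'.uι y) = g'.uι (D y) := hD.uDeriv_uι hp hodd hpF
  have hσδ : ∀ a, σ (δ a) = (χ.toFun α α : F) • δ (σ a) := hD.uTwist_uDeriv hp hodd hpF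
  have hχ : χ.toFun α α ^ (k + 1) = 1 := by
    rcases hk with ⟨-, hα, -⟩ | ⟨hk, -, -⟩
    · rw [hα, one_pow]
    · rw [hk, sq, χ.mul_swap]
  have hσc : σ c' = c' := by
    rw [hσdef, hc', g'.uTwist_uι α (x := c) hc, χ.toFun_nsmul_right, hχ, Units.val_one, one_smul]
  have hδc : δ c' = 0 := by
    rw [hc', hδι, show D c = 0 from Subtype.ext hxc, map_zero]
  have hk' : ((k + 1).Prime ∧ ((k + 1 : ℕ) : F) = 0 ∧
      ∀ a, σ.toLinearMap (δ a) = δ (σ.toLinearMap a)) ∨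
      (k + 1 = 2 ∧ ∀ a, σ.toLinearMap (δ a) = -δ (σ.toLinearMap a)) := by
    rcases hk with ⟨hk, hα, -⟩ | ⟨hk, hα, -⟩
    · refine Or.inl ⟨hk ▸ hp, hk ▸ hpF, fun a => ?_⟩
      have h := hσδ a
      rwa [hα, Units.val_one, one_smul] at h
    · refine Or.inr ⟨hk, fun a => ?_⟩
      have h := hσδ a
      rwa [χ.val_self_of_not_even hα, neg_one_smul] at h
  have hσ1 : σ 1 = 1 := map_one σ
  have hδ1 : δ 1 = 0 := derivation_one σ.toLinearMap δ hσ1 hδ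
  have hσk (β : Γ) (y : H) (hy : (y : L) ∈ g.comp β) (m : ℕ) :
      σ^[m] (g'.uι y) = (χ.toFun α β : F) ^ m • g'.uι y := by
    induction m with
    | zero => simp
    | succ m ih =>
      rw [Function.iterate_succ_apply', ih, map_smul, hσdef, g'.uTwist_uι α (x := y) hy, smul_smul,
        pow_succ]
  have hδk : ∀ a, δ^[k + 1] a = c' * a - σ^[k + 1] a * c' := by
    intro a
    induction a using g'.enveloping_induction with
    | one =>
      rw [Function.iterate_succ_apply, hδ1, Function.iterate_fixed (map_zero δ),
        Function.iterate_fixed hσ1]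
      simp
    | add a b ha hb =>
      rw [← Module.End.coe_pow] at ha hb ⊢
      rw [map_add, ha, hb, mul_add, ← AlgHom.coe_pow, map_add, add_mul]
      abel
    | smul r a ha =>
      rw [← Module.End.coe_pow] at ha ⊢
      rw [map_smul, ha, ← AlgHom.coe_pow, map_smul, smul_sub, smul_mul_assoc, mul_smul_comm]
    | mul β y a hy ha =>
      -- With left multiplications in the role of `φ` and δ in that of `X`, this says that `δ^(k+1)`
      -- is a `σ^(k+1)`-derivation. So is `a ↦ c a - σ^(k+1)(a) c`, hence agreement on generators
      -- suffices.
      have h1 := pow_mul_twisted (LinearMap.mul F g'.RestrictedEnveloping) σ.toLinearMap δ δ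
        (fun a => LinearMap.ext fun b => by simp [hδ, add_comm]) (k + 1) hk' (g'.uι y)
      have h2 := LinearMap.congr_fun h1 a
      simp only [Module.End.mul_apply, LinearMap.add_apply, LinearMap.mul_apply',
        Module.End.coe_pow, AlgHom.coe_toLinearMap] at h2
      have h3 : δ^[k + 1] (g'.uι y) = c' * g'.uι y - σ^[k + 1] (g'.uι y) * c' := by
        have h4 (m : ℕ) : δ^[m] (g'.uι y) = g'.uι (D^[m] y) := by
          induction m with
          | zero => rfl
          | succ m ih =>
            rw [Function.iterate_succ_apply', Function.iterate_succ_apply', ih, hδι]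
        have h5 (m : ℕ) : (D^[m] y : L) = (g.br x)^[m] y := by
          induction m with
          | zero => rfl
          | succ m ih =>
            rw [Function.iterate_succ_apply', Function.iterate_succ_apply', ← ih]; rfl
        have h6 : D^[k + 1] y = g'.br c y := Subtype.ext ((h5 _).trans (hbrc y))
        rw [h4, h6, ← g'.uι_mul (x := c) hc hy, hσk β y hy, χ.toFun_nsmul_left,
          Units.val_pow_eq_pow_val, smul_mul_assoc]
      rw [h2, h3, ha, ← AlgHom.coe_pow, map_mul, AlgHom.coe_pow]
      noncomm_ring
  obtain ⟨π, f, hπf, hπx, hfx⟩ := hx.exists_projection htop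
  set l : g'.RestrictedEnveloping →ₐ[F] Module.End F (Fin (k + 1) → g'.RestrictedEnveloping) :=
    Algebra.lsmul F F _ with hl
  set X := oreShift σ.toLinearMap δ c' k with hX
  have hXl (a) : X * l a = l (σ a) * X + l (δ a) :=
    oreShift_mul_lsmul σ.toLinearMap δ c' k (map_mul σ) hδ a
  have hXk : X ^ (k + 1) = l c' :=
    oreShift_pow σ.toLinearMap δ c' k (map_mul σ) hσ1 hδ hσc hδc hk' hδk
  have hXm (m : ℕ) (hm : k + 1 = m) : X ^ m = l c' := by
    rw [← hXk]; exact congrArg (X ^ ·) hm.symm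
  let ρ : L →ₗ[F] Module.End F (Fin (k + 1) → g'.RestrictedEnveloping) :=
    l.toLinearMap ∘ₗ g'.uι ∘ₗ π + f.smulRight X
  have hρH (y : H) : ρ y = l (g'.uι y) := by
    simp [ρ, (hπf y).1, (hπf y).2]
  have hρx : ρ x = X := by simp [ρ, hπx, hfx]
  have hHH (β γ : Γ) (y z : H) (hy : (y : L) ∈ g.comp β) (hz : (z : L) ∈ g.comp γ) :
      ρ y * ρ z - (χ.toFun β γ : F) • (ρ z * ρ y) = ρ (g.br y z) := by
    rw [hρH, hρH, ← hH.coe_br, hρH, ← g'.uι_mul (x := y) hy hz, map_sub, map_smul, map_mul, map_mul]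
  have hxH (γ : Γ) (z : H) (hz : (z : L) ∈ g.comp γ) :
      ρ x * ρ z - (χ.toFun α γ : F) • (ρ z * ρ x) = ρ (g.br x z) := by
    rw [hρH, hρx, hXl, show g.br x z = (D z : H) from rfl, hρH, hδι, hσdef,
      g'.uTwist_uι α (x := z) hz, map_smul, smul_mul_assoc, add_sub_cancel_left]
  have hswap (β γ : Γ) (y z : L) (hy : y ∈ g.comp β) (hz : z ∈ g.comp γ)
      (h : ρ y * ρ z - (χ.toFun β γ : F) • (ρ z * ρ y) = ρ (g.br y z)) :
      ρ z * ρ y - (χ.toFun γ β : F) • (ρ y * ρ z) = ρ (g.br z y) := by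
    rw [g.skew hy hz, map_neg, map_smul, ← h, smul_sub, smul_smul, χ.val_mul_swap, one_smul,
      neg_sub]
  have hxx : ρ x * ρ x - (χ.toFun α α : F) • (ρ x * ρ x) = ρ (g.br x x) := by
    rcases hk with ⟨hk, hα, -⟩ | ⟨hk, hα, hcx⟩
    · rw [LieColorAlgebra.br_self_of_even _ hα hx.mem, hα, map_zero, Units.val_one, one_smul,
        sub_self]
      intro h2
      have h2' := (hF 2).1 (by exact_mod_cast h2)
      rw [(Nat.prime_dvd_prime_iff_eq hp Nat.prime_two).1 h2'] at hodd
      exact absurd hodd (by decide)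
    · rw [hcx, map_smul, hρH, ← hXm 2 hk, χ.val_self_of_not_even hα, hρx]
      exact mul_self_sub_neg_one_smul X
  -- A homogeneous element of `H + F x` either lies in `H` or has degree `α`, with both of its
  -- summands homogeneous of that degree. Bilinearity then reduces the relation to the pairs from
  -- `H` and `x`.
  have hbr : ∀ β γ u v, u ∈ g.comp β → v ∈ g.comp γ →
      ρ u * ρ v - (χ.toFun β γ : F) • (ρ v * ρ u) = ρ (g.br u v) := by
    have hadd (β γ : Γ) (u u' v : L)
        (h : ρ u * ρ v - (χ.toFun β γ : F) • (ρ v * ρ u) = ρ (g.br u v))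
        (h' : ρ u' * ρ v - (χ.toFun β γ : F) • (ρ v * ρ u') = ρ (g.br u' v)) (t : F) :
        ρ (u + t • u') * ρ v - (χ.toFun β γ : F) • (ρ v * ρ (u + t • u')) =
          ρ (g.br (u + t • u') v) := by
      simp only [map_add, map_smul, LinearMap.add_apply, LinearMap.smul_apply, ← h, ← h', add_mul,
        mul_add, smul_add, smul_sub, smul_mul_assoc, mul_smul_comm, smul_comm t]
      abel
    have hfirst (β γ : Γ) (y : H) (v : L) (hy : (y : L) ∈ g.comp β) (hv : v ∈ g.comp γ) :
        ρ y * ρ v - (χ.toFun β γ : F) • (ρ v * ρ y) = ρ (g.br y v) := by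
      obtain ⟨z, hz, s, rfl⟩ := mem_sup_span_singleton.1 (htop ▸ Submodule.mem_top : v ∈ H ⊔ F ∙ x)
      by_cases hs : s = 0
      · subst hs
        rw [zero_smul, add_zero] at hv ⊢
        exact hHH β γ y ⟨z, hz⟩ hy hv
      · obtain rfl := hx.eq_of_add_smul_mem hH hz hs hv
        have hzα : z ∈ g.comp α := by
          simpa using sub_mem hv ((g.comp α).smul_mem s hx.mem)
        refine hswap _ _ _ _ hv hy (hadd _ _ _ _ _ ?_ ?_ s)
        · exact hHH α β ⟨z, hz⟩ y hzα hy
        · exact hxH β y hy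
    intro β γ u v hu hv
    obtain ⟨y, hy, t, rfl⟩ := mem_sup_span_singleton.1 (htop ▸ Submodule.mem_top : u ∈ H ⊔ F ∙ x)
    by_cases ht : t = 0
    · subst ht
      rw [zero_smul, add_zero] at hu ⊢
      exact hfirst β γ ⟨y, hy⟩ v hu hv
    · obtain rfl := hx.eq_of_add_smul_mem hH hy ht hu
      have hyα : y ∈ g.comp α := by
        simpa using sub_mem hu ((g.comp α).smul_mem t hx.mem)
      refine hadd _ _ _ _ _ (hfirst α γ ⟨y, hy⟩ v hyα hv) ?_ t
      obtain ⟨z, hz, s, rfl⟩ := mem_sup_span_singleton.1 (htop ▸ Submodule.mem_top : v ∈ H ⊔ F ∙ x)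
      by_cases hs : s = 0
      · subst hs
        rw [zero_smul, add_zero] at hv ⊢
        exact hxH γ ⟨z, hz⟩ hv
      · obtain rfl := hx.eq_of_add_smul_mem hH hz hs hv
        have hzα : z ∈ g.comp α := by
          simpa using sub_mem hv ((g.comp α).smul_mem s hx.mem)
        exact hswap _ _ _ _ hv hx.mem (hadd _ _ _ _ _
          (hswap _ _ _ _ hx.mem hzα (hxH α ⟨z, hz⟩ hzα)) hxx s)
  have hpow : ∀ β u, χ.Even β → u ∈ g.comp β → ρ u ^ p = ρ (g.pmap u) := by
    intro β u hβ hu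
    have hHp (y : H) (hy : (y : L) ∈ g.comp β) : ρ y ^ p = ρ (g.pmap y) := by
      rw [← hH.coe_pmap hβ hy, hρH, hρH, ← map_pow, g'.uι_pow hβ hy]
    obtain ⟨y, hy, t, rfl⟩ := mem_sup_span_singleton.1 (htop ▸ Submodule.mem_top : u ∈ H ⊔ F ∙ x)
    by_cases ht : t = 0
    · subst ht
      rw [zero_smul, add_zero] at hu ⊢
      exact hHp ⟨y, hy⟩ hu
    · obtain rfl := hx.eq_of_add_smul_mem hH hy ht hu
      have htx := (g.comp α).smul_mem t hx.mem
      have hyα : y ∈ g.comp α := by simpa using sub_mem hu htx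
      refine g.pow_pmap_add hp hodd hF ρ hbr hβ hyα htx (hHp ⟨y, hy⟩ hyα)
        (g.pow_pmap_smul ρ hβ hx.mem t ?_)
      rcases hk with ⟨hk, -, hcx⟩ | ⟨-, hα, -⟩
      · rw [hcx, hρH, ← hXm p hk, hρx]
      · exact absurd hβ hα
  refine ⟨g.lift ρ hbr hpow, δ, hδ, fun y => ?_, ?_⟩
  · rw [lift_uι, hρH]
  · rw [lift_uι, hρx]

/-- Evaluation at the vector `1` maps `u(g)` onto the module: `u x^i` goes to `a t^i` when `u` acts
as left multiplication by `a`. -/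
theorem IsExtension.mul_finrank_le (hp : p.Prime) (hodd : Odd p)
    (hF : ∀ i : ℕ, (i : F) = 0 ↔ p ∣ i) (h3 : (3 : F) ≠ 0) [Module.Finite F g.RestrictedEnveloping]
    (hH : g.IsRestrictedSub H) (hx : g.IsExtension H α x) (htop : H ⊔ F ∙ x = ⊤) :
    (open Classical in if χ.Even α then p else 2) *
      Module.finrank F hH.toAlgebra.RestrictedEnveloping ≤
        Module.finrank F g.RestrictedEnveloping := by
  have h2 : (2 : F) ≠ 0 := by
    intro h2
    have h2' := (hF 2).1 (by exact_mod_cast h2)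
    rw [(Nat.prime_dvd_prime_iff_eq hp Nat.prime_two).1 h2'] at hodd
    exact absurd hodd (by decide)
  have key : ∀ (k : ℕ) (c : H), (c : L) ∈ g.comp ((k + 1) • α) → g.br x c = 0 →
      (∀ y, (g.br x)^[k + 1] y = g.br c y) →
      ((k + 1 = p ∧ χ.Even α ∧ g.pmap x = c) ∨
        (k + 1 = 2 ∧ ¬ χ.Even α ∧ g.br x x = (2 : F) • (c : L))) →
      (k + 1) * Module.finrank F hH.toAlgebra.RestrictedEnveloping ≤
        Module.finrank F g.RestrictedEnveloping := by
    intro k c hc hxc hbrc hk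
    obtain ⟨ρ, δ, hδ, hρH, hρx⟩ :=
      hx.exists_representation hp hodd hF hH htop c hc hxc hbrc hk
    set A := hH.toAlgebra.RestrictedEnveloping
    have hl (a : A) : (Algebra.lsmul F F (Fin (k + 1) → A) a) ∈ ρ.range := by
      have hle : ⊤ ≤ ρ.range.comap (Algebra.lsmul F F (Fin (k + 1) → A) :
          A →ₐ[F] Module.End F (Fin (k + 1) → A)) := by
        rw [← hH.toAlgebra.adjoin_range_uι, Algebra.adjoin_le_iff]
        rintro _ ⟨y, rfl⟩
        exact ⟨g.uι y, hρH y⟩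
      exact hle (Algebra.mem_top (x := a))
    let ev : g.RestrictedEnveloping →ₗ[F] (Fin (k + 1) → A) :=
      LinearMap.applyₗ (Pi.single 0 1 : Fin (k + 1) → A) ∘ₗ ρ.toLinearMap
    have hsurj : Function.Surjective ev := by
      rw [← LinearMap.range_eq_top, eq_top_iff]
      intro f _
      rw [← Finset.univ_sum_single f]
      refine sum_mem fun i _ => ?_
      obtain ⟨u, hu⟩ := hl (f i)
      refine ⟨u * g.uι x ^ (i : ℕ), ?_⟩
      change ρ (u * g.uι x ^ (i : ℕ)) (Pi.single 0 1) = _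
      rw [map_mul, map_pow, hρx, Module.End.mul_apply,
        oreShift_pow_single_zero (hH.toAlgebra.uTwist α).toLinearMap δ _ k
          (map_one (hH.toAlgebra.uTwist α)) hδ i]
      change ρ u = _ at hu
      rw [hu]
      funext j
      change f i * (Pi.single i (1 : A) : Fin (k + 1) → A) j = _
      by_cases h : j = i
      · subst h; simp
      · rw [Pi.single_eq_of_ne h, Pi.single_eq_of_ne h, mul_zero]
    have : Module.Finite F (Fin (k + 1) → A) := Module.Finite.of_surjective ev hsurj
    have : Module.Finite F A := Module.Finite.of_surjective (LinearMap.proj (R := F) (φ := fun _ : Fin (k + 1) => A) 0)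
      (Function.surjective_eval 0)
    have h := LinearMap.finrank_le_finrank_of_surjective hsurj
    rwa [Module.finrank_pi_fintype, Finset.sum_const, Finset.card_univ, Fintype.card_fin, smul_eq_mul] at h
  split_ifs with hα
  · obtain ⟨k, rfl⟩ := Nat.exists_eq_succ_of_ne_zero hp.ne_zero
    refine key k ⟨g.pmap x, hx.pmap_mem hα⟩ (g.pmap_mem hα hx.mem) ?_
      (fun y => (g.br_pmap hα hx.mem y).symm) (Or.inl ⟨rfl, hα, rfl⟩)
    change g.br x (g.pmap x) = 0
    rw [g.skew (g.pmap_mem hα hx.mem) hx.mem, g.br_pmap hα hx.mem, Function.iterate_succ_apply,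
      LieColorAlgebra.br_self_of_even h2 hα hx.mem, Function.iterate_fixed (map_zero _), smul_zero,
      neg_zero]
  · have hxx : g.br x x = (2 : F) • (2 : F)⁻¹ • g.br x x := by
      rw [smul_smul, mul_inv_cancel₀ h2, one_smul]
    refine key 1 ⟨(2 : F)⁻¹ • g.br x x, H.smul_mem _ (hx.br_self_mem hα)⟩ ?_ ?_ ?_
      (Or.inr ⟨rfl, hα, hxx⟩)
    · rw [one_add_one_eq_two, two_nsmul]
      exact (g.comp _).smul_mem _ (g.br_mem hx.mem hx.mem)
    · change g.br x ((2 : F)⁻¹ • g.br x x) = 0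
      rw [map_smul, LieColorAlgebra.br_self_br_self h3 hα hx.mem, smul_zero]
    · intro y
      change g.br x (g.br x y) = g.br ((2 : F)⁻¹ • g.br x x) y
      rw [map_smul, LinearMap.smul_apply, LieColorAlgebra.br_br_self' hα hx.mem, smul_smul,
        inv_mul_cancel₀ h2, one_smul]

end RestrictedLieColorAlgebra

/-! ### Words in a homogeneous basis, filtered by length and degree -/

namespace RestrictedLieColorAlgebra

section Words

variable {F : Type*} [Field F] {p : ℕ} {Γ : Type*} [AddCommGroup Γ] [DecidableEq Γ]
  {χ : Bicharacter F Γ} {L : Type*} [AddCommGroup L] [Module F L]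
  (g : RestrictedLieColorAlgebra p χ L) {n : ℕ}

omit [DecidableEq Γ] in
theorem tau_of_even {d : Fin n → Γ} {i : Fin n} (h : χ.Even (d i)) : tau p χ d i = p - 1 := if_pos h

omit [DecidableEq Γ] in
theorem tau_of_not_even {d : Fin n → Γ} {i : Fin n} (h : ¬ χ.Even (d i)) : tau p χ d i = 1 :=
  if_neg h

/-- The product in `u(g)` of a word in the elements `e i`. -/
noncomputable def word (e : Fin n → L) (w : List (Fin n)) : g.RestrictedEnveloping :=
  (w.map fun i => g.uι (e i)).prod

@[simp] theorem word_nil (e : Fin n → L) : g.word e [] = 1 := rfl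

@[simp] theorem word_cons (e : Fin n → L) (i : Fin n) (w : List (Fin n)) :
    g.word e (i :: w) = g.uι (e i) * g.word e w := by simp [word]

theorem word_append (e : Fin n → L) (w w' : List (Fin n)) :
    g.word e (w ++ w') = g.word e w * g.word e w' := by simp [word]

/-- The span of the words of degree `β` and length less than `m`. -/
noncomputable def filt (e : Fin n → L) (d : Fin n → Γ) (m : ℕ) (β : Γ) :
    Submodule F g.RestrictedEnveloping :=
  Submodule.span F {z | ∃ w : List (Fin n), w.length < m ∧ (w.map d).sum = β ∧ g.word e w = z}

variable {g} {e : Fin n → L} {d : Fin n → Γ}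

theorem word_mem_filt {w : List (Fin n)} {m : ℕ} {β : Γ} (hm : w.length < m)
    (hβ : (w.map d).sum = β) : g.word e w ∈ g.filt e d m β :=
  Submodule.subset_span ⟨w, hm, hβ, rfl⟩

theorem filt_mono {m m' : ℕ} (h : m ≤ m') (β : Γ) : g.filt e d m β ≤ g.filt e d m' β :=
  Submodule.span_mono fun _ ⟨w, hw, hβ, hz⟩ => ⟨w, hw.trans_le h, hβ, hz⟩

theorem word_mul_mem_filt {w : List (Fin n)} {m k : ℕ} {α β γ : Γ} {a : g.RestrictedEnveloping}
    (ha : a ∈ g.filt e d m β) (hα : (w.map d).sum = α) (hγ : α + β = γ) (hk : w.length + m ≤ k) :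
    g.word e w * a ∈ g.filt e d k γ := by
  induction ha using Submodule.span_induction with
  | mem z hz =>
    obtain ⟨w', hw', hβ, rfl⟩ := hz
    rw [← word_append]
    exact word_mem_filt (by rw [List.length_append]; omega) (by simp [hα, hβ, hγ])
  | zero => rw [mul_zero]; exact zero_mem _
  | add x y _ _ hx hy => rw [mul_add]; exact add_mem hx hy
  | smul r x _ hx => rw [mul_smul_comm]; exact Submodule.smul_mem _ r hx

theorem mul_word_mem_filt {w : List (Fin n)} {m k : ℕ} {α β γ : Γ} {a : g.RestrictedEnveloping}
    (ha : a ∈ g.filt e d m β) (hα : (w.map d).sum = α) (hγ : β + α = γ) (hk : m + w.length ≤ k) :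
    a * g.word e w ∈ g.filt e d k γ := by
  induction ha using Submodule.span_induction with
  | mem z hz =>
    obtain ⟨w', hw', hβ, rfl⟩ := hz
    rw [← word_append]
    exact word_mem_filt (by rw [List.length_append]; omega) (by simp [hα, hβ, hγ])
  | zero => rw [zero_mul]; exact zero_mem _
  | add x y _ _ hx hy => rw [add_mul]; exact add_mem hx hy
  | smul r x _ hx => rw [smul_mul_assoc]; exact Submodule.smul_mem _ r hx

/-- The bound is `l + 1` because the filtration uses strict inequalities: lengths at most `m - 1`
and `k - 1` add up to less than `m + k - 1`. -/
theorem mul_mem_filt {m k l : ℕ} {α β γ : Γ} {a b : g.RestrictedEnveloping}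
    (ha : a ∈ g.filt e d m α) (hb : b ∈ g.filt e d k β) (hγ : α + β = γ) (hl : m + k ≤ l + 1) :
    a * b ∈ g.filt e d l γ := by
  induction hb using Submodule.span_induction with
  | mem z hz =>
    obtain ⟨w', hw', hβ, rfl⟩ := hz
    exact mul_word_mem_filt ha hβ hγ (by omega)
  | zero => rw [mul_zero]; exact zero_mem _
  | add x y _ _ hx hy => rw [mul_add]; exact add_mem hx hy
  | smul r x _ hx => rw [mul_smul_comm]; exact Submodule.smul_mem _ r hx

end Words

section Basis

variable {F : Type*} [Field F] {p : ℕ} {Γ : Type*} [AddCommGroup Γ] [DecidableEq Γ]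
  {χ : Bicharacter F Γ} {L : Type*} [AddCommGroup L] [Module F L]
  {g : RestrictedLieColorAlgebra p χ L} {n : ℕ} {e : Module.Basis (Fin n) F L} {d : Fin n → Γ}
  (he : ∀ i, e i ∈ g.comp (d i))
include he

/-- The `i`-th coordinate is unchanged by first projecting to degree `d i`, as one sees on the
basis, and this projection kills `x`. -/
theorem repr_eq_zero_of_mem_comp {α : Γ} {x : L} (hx : x ∈ g.comp α) {i : Fin n} (hi : d i ≠ α) :
    e.repr x i = 0 := by
  let _ := g.isInternal.chooseDecomposition
  let P : L →ₗ[F] L := (g.comp (d i)).subtype ∘ₗ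
    DirectSum.component F Γ (fun γ => g.comp γ) (d i) ∘ₗ
      (DirectSum.decomposeLinearEquiv g.comp).toLinearMap
  have hP (y : L) : P y = (DirectSum.decompose g.comp y (d i) : g.comp (d i)) := rfl
  have h1 : e.coord i ∘ₗ P = e.coord i := by
    refine e.ext fun j => ?_
    rw [LinearMap.comp_apply, hP]
    by_cases h : d j = d i
    · rw [← h, DirectSum.decompose_of_mem_same _ (he j)]
    · rw [DirectSum.decompose_of_mem_ne _ (he j) h, map_zero, Module.Basis.coord_apply,
        Module.Basis.repr_self, Finsupp.single_eq_of_ne]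
      rintro rfl
      exact h rfl
  have h2 := LinearMap.congr_fun h1 x
  rw [LinearMap.comp_apply, hP, DirectSum.decompose_of_mem_ne _ hx (Ne.symm hi), map_zero] at h2
  exact h2.symm

theorem comp_eq_span (α : Γ) :
    g.comp α = Submodule.span F (Set.range fun i : {i // d i = α} => e i) := by
  refine le_antisymm (fun x hx => ?_) ?_
  · rw [← e.sum_repr x]
    refine sum_mem fun i _ => ?_
    by_cases h : d i = α
    · exact Submodule.smul_mem _ _ (Submodule.subset_span ⟨⟨i, h⟩, rfl⟩)
    · rw [repr_eq_zero_of_mem_comp he hx h, zero_smul]; exact zero_mem _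
  · rw [Submodule.span_le]
    rintro _ ⟨⟨i, rfl⟩, rfl⟩
    exact he i

theorem finrank_comp (α : Γ) : Module.finrank F (g.comp α) = Fintype.card {i // d i = α} := by
  rw [comp_eq_span he α]
  exact finrank_span_eq_card (e.linearIndependent.comp _ Subtype.val_injective)

theorem uι_mem_filt {α : Γ} {x : L} (hx : x ∈ g.comp α) : g.uι x ∈ g.filt e d 2 α := by
  rw [comp_eq_span he α] at hx
  induction hx using Submodule.span_induction with
  | mem y hy =>
    obtain ⟨⟨i, hi⟩, rfl⟩ := hy
    have : g.uι (e i) = g.word e [i] := by simp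
    rw [this]
    exact word_mem_filt (by simp) (by simpa using hi)
  | zero => rw [map_zero]; exact zero_mem _
  | add y z _ _ hy hz => rw [map_add]; exact add_mem hy hz
  | smul r y _ hy => rw [map_smul]; exact Submodule.smul_mem _ r hy

theorem exists_mem_filt {β : Γ} {z : g.RestrictedEnveloping} (hz : z ∈ g.uGrading β) :
    ∃ m, z ∈ g.filt e d m β := by
  induction hz using Submodule.span_induction with
  | mem z hz =>
    obtain ⟨l, hl, rfl, rfl⟩ := hz
    induction l with
    | nil => exact ⟨1, word_mem_filt (w := []) (by simp) (by simp)⟩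
    | cons q l ih =>
      obtain ⟨m, hm⟩ := ih fun r hr => hl r (List.mem_cons_of_mem _ hr)
      refine ⟨m + 1, ?_⟩
      rw [List.map_cons, List.map_cons, List.prod_cons, List.sum_cons]
      exact mul_mem_filt (uι_mem_filt he (hl q List.mem_cons_self)) hm rfl (by omega)
  | zero => exact ⟨0, zero_mem _⟩
  | add x y _ _ hx hy =>
    obtain ⟨m, hm⟩ := hx
    obtain ⟨k, hk⟩ := hy
    exact ⟨max m k, add_mem (filt_mono (le_max_left _ _) _ hm) (filt_mono (le_max_right _ _) _ hk)⟩
  | smul r x _ hx =>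
    obtain ⟨m, hm⟩ := hx
    exact ⟨m, Submodule.smul_mem _ r hm⟩

/-- Up to shorter words and nonzero scalars, the letters of a word may be permuted. -/
theorem exists_word_sub_smul_mem_filt_of_perm {w w' : List (Fin n)} (h : w.Perm w') :
    ∃ κ : F, κ ≠ 0 ∧ g.word e w - κ • g.word e w' ∈ g.filt e d w.length (w.map d).sum := by
  induction h with
  | nil => exact ⟨1, one_ne_zero, by simp⟩
  | @cons i w w' _ ih =>
    obtain ⟨κ, hκ, h⟩ := ih
    refine ⟨κ, hκ, ?_⟩
    have h1 : g.word e (i :: w) - κ • g.word e (i :: w') =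
        g.word e [i] * (g.word e w - κ • g.word e w') := by
      rw [word_cons, word_cons, mul_sub, mul_smul_comm]; simp
    rw [h1]
    exact word_mul_mem_filt h rfl (by simp) (by simp [add_comm])
  | swap i j w =>
    refine ⟨χ.toFun (d j) (d i), Units.ne_zero _, ?_⟩
    have h1 : g.word e (j :: i :: w) - (χ.toFun (d j) (d i) : F) • g.word e (i :: j :: w) =
        g.uι (g.br (e j) (e i)) * g.word e w := by
      rw [← g.uι_mul (he j) (he i)]
      simp only [word_cons, sub_mul, smul_mul_assoc, mul_assoc]
    rw [h1]
    exact mul_word_mem_filt (uι_mem_filt he (g.br_mem (he j) (he i))) rfl (by simp [add_assoc])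
      (by simp; omega)
  | @trans w₁ w₂ w₃ h12 _ ih ih' =>
    obtain ⟨κ, hκ, h⟩ := ih
    obtain ⟨κ', hκ', h'⟩ := ih'
    refine ⟨κ * κ', mul_ne_zero hκ hκ', ?_⟩
    rw [← h12.length_eq, ← (h12.map d).sum_eq] at h'
    have := add_mem h (Submodule.smul_mem _ κ h')
    rwa [smul_sub, smul_smul, sub_add_sub_cancel] at this

/-- A word in which a letter occurs too often is a combination of shorter words. -/
theorem word_mem_filt_of_tau_lt_count (hp : 1 < p) (h2 : (2 : F) ≠ 0) {w : List (Fin n)} {i : Fin n}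
    (hi : tau p χ d i < w.count i) : g.word e w ∈ g.filt e d w.length (w.map d).sum := by
  -- The excess copies are gathered in front, where `e_i^(τ(i)+1)` equals `e_i^[p]` or
  -- `[e_i,e_i]/2`, an element of `g`; at least two letters are thereby replaced by at most one.
  obtain ⟨w', hw'⟩ := (List.replicate_sublist_iff.2 (Nat.succ_le_of_lt hi)).exists_perm_append
  obtain ⟨κ, -, h⟩ := exists_word_sub_smul_mem_filt_of_perm he hw'
  have hrep : g.word e (List.replicate (tau p χ d i + 1) i) ∈
      g.filt e d 2 ((tau p χ d i + 1) • d i) := by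
    have h1 : g.word e (List.replicate (tau p χ d i + 1) i) = g.uι (e i) ^ (tau p χ d i + 1) := by
      simp [word]
    rw [h1]
    by_cases hd : χ.Even (d i)
    · rw [tau_of_even hd, Nat.sub_add_cancel hp.le, g.uι_pow hd (he i)]
      exact uι_mem_filt he (g.pmap_mem hd (he i))
    · rw [tau_of_not_even hd, one_add_one_eq_two, two_nsmul]
      have h3 := g.uι_mul (he i) (he i)
      rw [χ.val_self_of_not_even hd, neg_smul, one_smul, sub_neg_eq_add, ← two_smul F, ← sq] at h3
      have h4 : g.uι (e i) ^ 2 = (2 : F)⁻¹ • g.uι (g.br (e i) (e i)) := by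
        rw [← h3, smul_smul, inv_mul_cancel₀ h2, one_smul]
      rw [h4]
      exact Submodule.smul_mem _ _ (uι_mem_filt he (g.br_mem (he i) (he i)))
  have hτ : 1 ≤ tau p χ d i := by
    by_cases hd : χ.Even (d i)
    · rw [tau_of_even hd]; omega
    · rw [tau_of_not_even hd]
  have hlen := hw'.length_eq
  rw [List.length_append, List.length_replicate] at hlen
  have hdeg := (hw'.map d).sum_eq
  rw [List.map_append, List.sum_append, List.map_replicate, List.sum_replicate] at hdeg
  have h5 : g.word e (List.replicate (tau p χ d i + 1) i ++ w') ∈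
      g.filt e d w.length (w.map d).sum := by
    rw [word_append]
    exact mul_word_mem_filt hrep rfl hdeg.symm (by omega)
  have := add_mem h (Submodule.smul_mem _ κ h5)
  rwa [sub_add_cancel] at this

/-- Generators color-commute with words up to shorter words. -/
theorem uι_mul_word_sub_mem_filt (i : Fin n) (w : List (Fin n)) :
    g.uι (e i) * g.word e w -
      (χ.toFun (d i) (w.map d).sum : F) • (g.word e w * g.uι (e i)) ∈
        g.filt e d (w.length + 1) (d i + (w.map d).sum) := by
  induction w with
  | nil => simp [χ.toFun_zero_right]
  | cons j w ih =>
    have h1 : g.uι (e i) * g.word e (j :: w) -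
        (χ.toFun (d i) ((j :: w).map d).sum : F) • (g.word e (j :: w) * g.uι (e i)) =
        g.uι (g.br (e i) (e j)) * g.word e w + (χ.toFun (d i) (d j) : F) • (g.word e [j] *
          (g.uι (e i) * g.word e w -
            (χ.toFun (d i) (w.map d).sum : F) • (g.word e w * g.uι (e i)))) := by
      rw [← g.uι_mul (he i) (he j), List.map_cons, List.sum_cons, χ.add_right, Units.val_mul]
      simp only [word_cons, word_nil, mul_one, sub_mul, mul_sub, smul_sub, smul_mul_assoc, mul_assoc,
        mul_smul_comm, smul_smul]
      abel
    rw [h1]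
    refine add_mem ?_ (Submodule.smul_mem _ _ ?_)
    · exact mul_word_mem_filt (uι_mem_filt he (g.br_mem (he i) (he j))) rfl (by simp [add_assoc])
        (by simp; omega)
    · exact word_mul_mem_filt ih rfl (by simp; abel) (by simp; omega)

end Basis

/-! ### Spanning by restricted monomials -/

section Monomials

variable {F : Type*} [Field F] {p : ℕ} {Γ : Type*} [AddCommGroup Γ] [DecidableEq Γ]
  {χ : Bicharacter F Γ} {L : Type*} [AddCommGroup L] [Module F L]
  {g : RestrictedLieColorAlgebra p χ L} {n : ℕ}

/-- The nondecreasing word in which the letter `i` occurs `a i` times. -/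
def sortedWord (a : Fin n → ℕ) : List (Fin n) :=
  (List.ofFn fun i => List.replicate (a i) i).flatten

theorem count_sortedWord (a : Fin n → ℕ) (i : Fin n) : (sortedWord a).count i = a i := by
  rw [sortedWord, List.count_flatten, List.map_ofFn, List.sum_ofFn]
  simp [List.count_replicate]

theorem word_sortedWord (e : Fin n → L) (a : Fin n → ℕ) :
    g.word e (sortedWord a) = g.monomial e a := by
  simp [word, sortedWord, monomial, List.map_flatten, List.prod_flatten, List.map_ofFn,
    Function.comp_def]

theorem map_sum_eq_sum_count {M : Type*} [AddCommMonoid M] (w : List (Fin n)) (f : Fin n → M) :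
    (w.map f).sum = ∑ i, w.count i • f i := by
  rw [Finset.sum_list_map_count]
  refine Finset.sum_subset (Finset.subset_univ _) fun i _ hi => ?_
  rw [List.count_eq_zero_of_not_mem (by simpa using hi), zero_smul]

theorem length_eq_sum_count (w : List (Fin n)) : w.length = ∑ i, w.count i := by
  have h := map_sum_eq_sum_count w fun _ => 1
  simpa using h

variable {e : Module.Basis (Fin n) F L} {d : Fin n → Γ} (he : ∀ i, e i ∈ g.comp (d i))
include he

theorem exists_word_sub_smul_monomial_mem_filt (w : List (Fin n)) :
    ∃ κ : F, κ ≠ 0 ∧ g.word e w - κ • g.monomial e (fun i => w.count i) ∈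
      g.filt e d w.length (w.map d).sum := by
  rw [← word_sortedWord]
  refine exists_word_sub_smul_mem_filt_of_perm he ?_
  rw [List.perm_iff_count]
  intro i
  rw [count_sortedWord]

/-- A word with too many copies of a letter reduces to shorter words; any other is a multiple of its
sorted monomial up to shorter words. Recording both length and degree is essential for controlling
the top coefficient later. -/
theorem filt_le_span_monomial (hp : 1 < p) (h2 : (2 : F) ≠ 0) (m : ℕ) (β : Γ) :
    g.filt e d m β ≤ Submodule.span F {z | ∃ a : (i : Fin n) → Fin (tau p χ d i + 1),
      ∑ i, (a i : ℕ) < m ∧ ∑ i, (a i : ℕ) • d i = β ∧ g.monomial e (fun i => a i) = z} := by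
  induction m with
  | zero =>
    refine Submodule.span_le.2 ?_
    rintro _ ⟨w, hw, -⟩
    exact absurd hw (Nat.not_lt_zero _)
  | succ m ih =>
    have hmono : ∀ z ∈ g.filt e d m β, z ∈ Submodule.span F
        {z | ∃ a : (i : Fin n) → Fin (tau p χ d i + 1),
          ∑ i, (a i : ℕ) < m + 1 ∧ ∑ i, (a i : ℕ) • d i = β ∧ g.monomial e (fun i => a i) = z} :=
      fun z hz => Submodule.span_mono
        (by rintro _ ⟨a, ha, h⟩; exact ⟨a, ha.trans (Nat.lt_succ_self m), h⟩) (ih hz)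
    refine Submodule.span_le.2 ?_
    rintro _ ⟨w, hw, rfl, rfl⟩
    have hwm : w.length ≤ m := Nat.le_of_lt_succ hw
    by_cases hcount : ∃ i, tau p χ d i < w.count i
    · obtain ⟨i, hi⟩ := hcount
      exact hmono _ (filt_mono hwm _ (word_mem_filt_of_tau_lt_count he hp h2 hi))
    · push Not at hcount
      obtain ⟨κ, -, h⟩ := exists_word_sub_smul_monomial_mem_filt he w
      have h1 := hmono _ (filt_mono hwm _ h)
      rw [← sub_add_cancel (g.word e w) (κ • g.monomial e fun i => w.count i)]
      refine add_mem h1 (Submodule.smul_mem _ _ (Submodule.subset_span ?_))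
      refine ⟨fun i => ⟨w.count i, Nat.lt_succ_of_le (hcount i)⟩, ?_, ?_, rfl⟩
      · rw [← length_eq_sum_count]; exact hw
      · rw [map_sum_eq_sum_count]

theorem uGrading_le_span_monomial (hp : 1 < p) (h2 : (2 : F) ≠ 0) (β : Γ) :
    g.uGrading β ≤ Submodule.span F {z | ∃ a : (i : Fin n) → Fin (tau p χ d i + 1),
      ∑ i, (a i : ℕ) • d i = β ∧ g.monomial e (fun i => a i) = z} := by
  intro z hz
  obtain ⟨m, hm⟩ := exists_mem_filt he hz
  exact Submodule.span_mono (by rintro _ ⟨a, _, h⟩; exact ⟨a, h⟩) (filt_le_span_monomial he hp h2 m β hm)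

theorem span_range_monomial (hp : 1 < p) (h2 : (2 : F) ≠ 0) :
    ⊤ ≤ Submodule.span F (Set.range fun a : (i : Fin n) → Fin (tau p χ d i + 1) =>
      g.monomial e (fun i => a i)) := by
  have h := (DirectSum.Decomposition.isInternal g.uGrading).submodule_iSup_eq_top
  rw [← h]
  refine iSup_le fun β => (uGrading_le_span_monomial he hp h2 β).trans (Submodule.span_mono ?_)
  rintro _ ⟨a, -, rfl⟩
  exact ⟨a, rfl⟩

end Monomials

end RestrictedLieColorAlgebra

/-! ### Dimension count and the PBW theorem -/

namespace RestrictedLieColorAlgebra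

section Dimension

variable {F : Type*} [Field F] {p : ℕ} {Γ : Type*} [AddCommGroup Γ] [DecidableEq Γ]
  {χ : Bicharacter F Γ} {L : Type*} [AddCommGroup L] [Module F L]

theorem finite_of_basis {g : RestrictedLieColorAlgebra p χ L} {n : ℕ} {e : Module.Basis (Fin n) F L}
    {d : Fin n → Γ} (he : ∀ i, e i ∈ g.comp (d i)) (hp : 1 < p) (h2 : (2 : F) ≠ 0) :
    Module.Finite F g.RestrictedEnveloping :=
  ⟨⟨(Set.finite_range _).toFinset, by
    rw [Set.Finite.coe_toFinset]
    exact top_le_iff.1 (span_range_monomial he hp h2)⟩⟩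

theorem nontrivial_restrictedEnveloping_of_subsingleton [Subsingleton L]
    (g : RestrictedLieColorAlgebra p χ L) (hp : p ≠ 0) : Nontrivial g.RestrictedEnveloping :=
  (g.lift (0 : L →ₗ[F] F) (by simp) (by simp [hp])).toRingHom.domain_nontrivial

/-- Existence of a homogeneous basis whose ordered monomials do not outnumber the dimension of
`u(g)`. -/
theorem exists_homogeneous_basis_prod_le_finrank (hp : p.Prime) (hodd : Odd p)
    (hF : ∀ i : ℕ, (i : F) = 0 ↔ p ∣ i) (h2 : (2 : F) ≠ 0) (h3 : (3 : F) ≠ 0)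
    [FiniteDimensional F L] (g : RestrictedLieColorAlgebra p χ L) (hg : g.IsUnipotent) :
    ∃ (n : ℕ) (e : Module.Basis (Fin n) F L) (d : Fin n → Γ), (∀ i, e i ∈ g.comp (d i)) ∧
      ∏ i, (tau p χ d i + 1) ≤ Module.finrank F g.RestrictedEnveloping := by
  generalize hN : Module.finrank F L = N
  induction N using Nat.strong_induction_on generalizing L with
  | _ N ih =>
    rcases subsingleton_or_nontrivial L with hL | hL
    · have he : ∀ i, (Module.Basis.empty L : Module.Basis (Fin 0) F L) i ∈
          g.comp ((fun i => 0 : Fin 0 → Γ) i) := fun i => i.elim0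
      have := finite_of_basis he hp.one_lt h2
      have := g.nontrivial_restrictedEnveloping_of_subsingleton hp.ne_zero
      refine ⟨0, _, _, he, ?_⟩
      rw [Finset.univ_eq_empty, Finset.prod_empty]
      exact Module.finrank_pos
    · obtain ⟨H, α, x, hH, hx, htop⟩ := exists_codim_one hp.ne_zero h2 hg
      have hlt : Module.finrank F H < N := by
        rw [← hN]
        refine Submodule.finrank_lt fun h => hx.notMem ?_
        rw [h]; trivial
      obtain ⟨n, e, d, he, hle⟩ := ih _ hlt hH.toAlgebra (hH.isUnipotent hg) rfl
      have hli : ∀ c : F, ∀ y ∈ H, c • x + y = 0 → c = 0 := by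
        intro c y hy hc
        by_contra hc0
        refine hx.notMem ?_
        have h := H.smul_mem c⁻¹ (neg_mem hy)
        rwa [← eq_neg_of_add_eq_zero_left hc, smul_smul, inv_mul_cancel₀ hc0, one_smul] at h
      have hsp : ∀ z : L, ∃ c : F, z + c • x ∈ H := by
        intro z
        obtain ⟨y, hy, t, rfl⟩ :=
          mem_sup_span_singleton.1 (htop ▸ Submodule.mem_top : z ∈ H ⊔ F ∙ x)
        refine ⟨-t, ?_⟩
        rwa [neg_smul, add_neg_cancel_right]
      have he' : ∀ i, Module.Basis.mkFinCons x e hli hsp i ∈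
          g.comp ((Fin.cons α d : Fin (n + 1) → Γ) i) := by
        intro i
        rw [Module.Basis.coe_mkFinCons]
        refine Fin.cases ?_ (fun i => ?_) i
        · exact hx.mem
        · exact he i
      have := finite_of_basis he' hp.one_lt h2
      refine ⟨n + 1, _, _, he', le_trans ?_ (hx.mul_finrank_le hp hodd hF h3 hH htop)⟩
      rw [Fin.prod_univ_succ]
      refine Nat.mul_le_mul (le_of_eq ?_) hle
      split_ifs with hα
      · rw [tau_of_even (by simpa using hα), Nat.sub_add_cancel hp.one_le]
      · rw [tau_of_not_even (by simpa using hα)]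

/-- Any homogeneous basis has dim `g_γ` members of degree `γ`, and `τ` depends on the degree alone.
This transfers the bound from the basis adapted to the flag to an arbitrary one. -/
theorem prod_tau_eq {g : RestrictedLieColorAlgebra p χ L} {n n' : ℕ}
    {e : Module.Basis (Fin n) F L} {d : Fin n → Γ} (he : ∀ i, e i ∈ g.comp (d i))
    {e' : Module.Basis (Fin n') F L} {d' : Fin n' → Γ} (he' : ∀ i, e' i ∈ g.comp (d' i)) :
    ∏ i, (tau p χ d i + 1) = ∏ i, (tau p χ d' i + 1) := by
  have hcard (γ : Γ) : Fintype.card {i // d i = γ} = Fintype.card {i // d' i = γ} := by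
    rw [← finrank_comp he, ← finrank_comp he']
  let E : Fin n ≃ Fin n' := Equiv.ofFiberEquiv fun γ => Fintype.equivOfCardEq (hcard γ)
  refine Fintype.prod_equiv E _ _ fun i => ?_
  have h : d' (E i) = d i := Equiv.ofFiberEquiv_map _ i
  unfold tau
  rw [h]

/-- The Poincaré–Birkhoff–Witt theorem for unipotent restricted Lie color algebras. -/
theorem exists_monomial_basis (hp : p.Prime) (hodd : Odd p)
    (hF : ∀ i : ℕ, (i : F) = 0 ↔ p ∣ i) (h2 : (2 : F) ≠ 0) (h3 : (3 : F) ≠ 0)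
    [FiniteDimensional F L] {g : RestrictedLieColorAlgebra p χ L} (hg : g.IsUnipotent) {n : ℕ}
    {e : Module.Basis (Fin n) F L} {d : Fin n → Γ} (he : ∀ i, e i ∈ g.comp (d i)) :
    ∃ B : Module.Basis ((i : Fin n) → Fin (tau p χ d i + 1)) F g.RestrictedEnveloping,
      ∀ a, B a = g.monomial e (fun i => (a i : ℕ)) := by
  -- The adapted basis supplies only the dimension bound; a spanning family no larger than the
  -- dimension is a basis.
  obtain ⟨n', e', d', he', hle⟩ := exists_homogeneous_basis_prod_le_finrank hp hodd hF h2 h3 g hg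
  rw [← prod_tau_eq he he'] at hle
  have hspan := span_range_monomial he hp.one_lt h2
  have hge : Module.finrank F g.RestrictedEnveloping ≤
      Fintype.card ((i : Fin n) → Fin (tau p χ d i + 1)) := by
    have h := finrank_range_le_card (R := F)
      (fun a : (i : Fin n) → Fin (tau p χ d i + 1) => g.monomial e (fun i => a i))
    rwa [Set.finrank, top_le_iff.1 hspan, finrank_top] at h
  have hcard : Fintype.card ((i : Fin n) → Fin (tau p χ d i + 1)) = ∏ i, (tau p χ d i + 1) := by
    rw [Fintype.card_pi]; simp
  exact ⟨basisOfTopLeSpanOfCardEqFinrank _ hspan (le_antisymm (hcard ▸ hle) hge),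
    fun a => by rw [coe_basisOfTopLeSpanOfCardEqFinrank]⟩

end Dimension

/-! ### The top coefficient: nondegeneracy and color symmetry -/

section FrobeniusForm

variable {F : Type*} [Field F] {p : ℕ} {Γ : Type*} [AddCommGroup Γ] [DecidableEq Γ]
  {χ : Bicharacter F Γ} {L : Type*} [AddCommGroup L] [Module F L]
  {g : RestrictedLieColorAlgebra p χ L} {n : ℕ}
  {e : Module.Basis (Fin n) F L} {d : Fin n → Γ}
  {B : Module.Basis ((i : Fin n) → Fin (tau p χ d i + 1)) F g.RestrictedEnveloping}

omit [DecidableEq Γ] in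
theorem sum_val_lt_of_ne_last {a : (i : Fin n) → Fin (tau p χ d i + 1)}
    (ha : a ≠ fun _ => Fin.last _) : ∑ i, (a i : ℕ) < ∑ i, tau p χ d i := by
  obtain ⟨i, hi⟩ := Function.ne_iff.1 ha
  exact Finset.sum_lt_sum (fun i _ => Nat.le_of_lt_succ (a i).2)
    ⟨i, Finset.mem_univ i, Fin.val_lt_last hi⟩

variable (he : ∀ i, e i ∈ g.comp (d i)) (hp : 1 < p) (h2 : (2 : F) ≠ 0)
  (hB : ∀ a, B a = g.monomial e (fun i => (a i : ℕ)))
include he hp h2 hB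

/-- The coefficient of the top monomial vanishes on short words. -/
theorem coord_last_eq_zero_of_mem_filt {m : ℕ} {β : Γ} {z : g.RestrictedEnveloping}
    (hz : z ∈ g.filt e d m β) (hm : m ≤ ∑ i, tau p χ d i ∨ ∑ i, tau p χ d i • d i ≠ β) :
    B.coord (fun _ => Fin.last _) z = 0 := by
  replace hz := filt_le_span_monomial he hp h2 m β hz
  rw [← LinearMap.mem_ker]
  refine Submodule.span_le.2 ?_ hz
  rintro _ ⟨a, ha, hdeg, rfl⟩
  rw [SetLike.mem_coe, LinearMap.mem_ker, ← hB, Module.Basis.coord_apply, Module.Basis.repr_self]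
  refine Finsupp.single_eq_of_ne ?_
  rintro rfl
  rcases hm with hm | hm
  · simp only [Fin.val_last] at ha
    omega
  · exact hm hdeg

theorem coord_last_word_ne_zero {w : List (Fin n)} (hw : ∀ i, w.count i = tau p χ d i) :
    B.coord (fun _ => Fin.last _) (g.word e w) ≠ 0 := by
  obtain ⟨κ, hκ, h⟩ := exists_word_sub_smul_monomial_mem_filt he w
  have h0 := coord_last_eq_zero_of_mem_filt he hp h2 hB h (Or.inl (by
    rw [length_eq_sum_count, Finset.sum_congr rfl fun i _ => hw i]))
  have h1 : g.monomial e (fun i => w.count i) = B fun _ => Fin.last _ := by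
    rw [hB]; simp only [Fin.val_last, hw]
  rw [h1, map_sub, map_smul, sub_eq_zero] at h0
  rw [h0, Module.Basis.coord_apply, Module.Basis.repr_self, Finsupp.single_eq_same, smul_eq_mul,
    mul_one]
  exact hκ

/-- The pairing of the monomial `e ^ b` with a complementary word `e ^ (τ - a)`, for `b` not longer
than `a`. -/
theorem coord_last_word_eq_zero {w : List (Fin n)}
    {a b : (i : Fin n) → Fin (tau p χ d i + 1)} (hba : b ≠ a)
    (hle : ∑ i, (b i : ℕ) ≤ ∑ i, (a i : ℕ))
    (hw : ∀ i, w.count i = (b i : ℕ) + (tau p χ d i - a i)) :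
    B.coord (fun _ => Fin.last _) (g.word e w) = 0 := by
  have hlen : w.length + ∑ i, (a i : ℕ) = ∑ i, (b i : ℕ) + ∑ i, tau p χ d i := by
    rw [length_eq_sum_count, Finset.sum_congr rfl fun i _ => hw i, Finset.sum_add_distrib, add_assoc,
      ← Finset.sum_add_distrib]
    congr 1
    refine Finset.sum_congr rfl fun i _ => ?_
    have := (a i).2
    omega
  -- The word has length at most `∑ τ`. If some `b_i` exceeds `a_i`, the letter `i` occurs more than
  -- `τ(i)` times and the word reduces to shorter ones; otherwise `b` is strictly below `a` and the
  -- word is already too short.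
  by_cases h : ∃ i, (a i : ℕ) < b i
  · obtain ⟨i, hi⟩ := h
    refine coord_last_eq_zero_of_mem_filt he hp h2 hB
      (word_mem_filt_of_tau_lt_count he hp h2 (i := i) ?_) (Or.inl (by omega))
    have := (a i).2
    rw [hw]
    omega
  · push Not at h
    obtain ⟨i, hi⟩ := Function.ne_iff.1 hba
    have hlt : ∑ i, (b i : ℕ) < ∑ i, (a i : ℕ) := Finset.sum_lt_sum (fun i _ => h i)
      ⟨i, Finset.mem_univ i, lt_of_le_of_ne (h i) fun h' => hi (Fin.ext h')⟩
    exact coord_last_eq_zero_of_mem_filt he hp h2 hB (word_mem_filt (Nat.lt_succ_self _) rfl)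
      (Or.inl (by omega))

/-- With `a` of maximal total exponent in the support of `u`, the monomial `e^(τ-a)` detects `e^a`
and no other monomial of the support. It does so on both sides, since only the letter counts of the
product matter. -/
theorem exists_coord_last_mul_ne_zero {u : g.RestrictedEnveloping} (hu : u ≠ 0) :
    ∃ v, B.coord (fun _ => Fin.last _) (u * v) ≠ 0 ∧ B.coord (fun _ => Fin.last _) (v * u) ≠ 0 := by
  have hsupp : (B.repr u).support.Nonempty := by
    rw [Finsupp.support_nonempty_iff]
    simpa using hu
  obtain ⟨a, ha, hmax⟩ := Finset.exists_max_image _ (fun a => ∑ i, (a i : ℕ)) hsupp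
  set c : Fin n → ℕ := fun i => tau p χ d i - a i with hc
  have hsum : ∀ T : g.RestrictedEnveloping →ₗ[F] F,
      (∀ b, b ≠ a → ∑ i, (b i : ℕ) ≤ ∑ i, (a i : ℕ) → T (B b) = 0) → T (B a) ≠ 0 → T u ≠ 0 := by
    intro T hT hTa
    rw [← B.sum_repr u, map_sum, Finset.sum_eq_single a]
    · rw [map_smul, smul_eq_mul]
      exact mul_ne_zero (Finsupp.mem_support_iff.1 ha) hTa
    · intro b _ hba
      by_cases hb : b ∈ (B.repr u).support
      · rw [map_smul, hT b hba (hmax b hb), smul_zero]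
      · rw [Finsupp.notMem_support_iff.1 hb, zero_smul, map_zero]
    · exact fun h => absurd (Finset.mem_univ a) h
  have hBw (b : (i : Fin n) → Fin (tau p χ d i + 1)) :
      B b = g.word e (sortedWord fun i => (b i : ℕ)) := by rw [hB, word_sortedWord]
  refine ⟨g.word e (sortedWord c), ?_, ?_⟩
  · refine hsum (B.coord _ ∘ₗ LinearMap.mulRight F (g.word e (sortedWord c))) ?_ ?_
    · intro b hba hle
      rw [LinearMap.comp_apply, LinearMap.mulRight_apply, hBw, ← word_append]
      refine coord_last_word_eq_zero he hp h2 hB hba hle fun i => ?_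
      rw [List.count_append, count_sortedWord, count_sortedWord]
    · rw [LinearMap.comp_apply, LinearMap.mulRight_apply, hBw, ← word_append]
      refine coord_last_word_ne_zero he hp h2 hB fun i => ?_
      rw [List.count_append, count_sortedWord, count_sortedWord]
      exact Nat.add_sub_cancel' (Nat.le_of_lt_succ (a i).2)
  · refine hsum (B.coord _ ∘ₗ LinearMap.mulLeft F (g.word e (sortedWord c))) ?_ ?_
    · intro b hba hle
      rw [LinearMap.comp_apply, LinearMap.mulLeft_apply, hBw, ← word_append]
      refine coord_last_word_eq_zero he hp h2 hB hba hle fun i => ?_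
      rw [List.count_append, count_sortedWord, count_sortedWord, add_comm]
    · rw [LinearMap.comp_apply, LinearMap.mulLeft_apply, hBw, ← word_append]
      refine coord_last_word_ne_zero he hp h2 hB fun i => ?_
      rw [List.count_append, count_sortedWord, count_sortedWord]
      exact Nat.sub_add_cancel (Nat.le_of_lt_succ (a i).2)

theorem isFrobeniusForm_mulForm_coord_last :
    IsFrobeniusForm (mulForm (B.coord fun _ => Fin.last _)) where
  invariant x y z := by
    change B.coord _ (x * y * z) = B.coord _ (x * (y * z))
    rw [mul_assoc]
  nondegenerate := by
    refine ⟨fun x hx => ?_, fun y hy => ?_⟩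
    · by_contra h0
      obtain ⟨v, hv, -⟩ := exists_coord_last_mul_ne_zero he hp h2 hB h0
      exact hv (hx v)
    · by_contra h0
      obtain ⟨v, -, hv⟩ := exists_coord_last_mul_ne_zero he hp h2 hB h0
      exact hv (hy v)

/-- A `p`-nilpotent generator of degree `0` has no top coefficient in its commutator with the top
monomial. -/
theorem coord_last_commutator_eq_zero (hpp : p.Prime) (hpF : (p : F) = 0) (hg : g.IsUnipotent)
    {i : Fin n} (hi : d i = 0) :
    B.coord (fun _ => Fin.last _) (g.uι (e i) * B (fun _ => Fin.last _)) =
      B.coord (fun _ => Fin.last _) (B (fun _ => Fin.last _) * g.uι (e i)) := by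
  set N := ∑ i, tau p χ d i with hN
  set δ := ∑ i, tau p χ d i • d i with hδ
  set top := B (fun _ => Fin.last _) with htop
  set φ := B.coord (fun _ => Fin.last _) with hφ
  have hφtop : φ top = 1 := by
    rw [hφ, htop, Module.Basis.coord_apply, Module.Basis.repr_self, Finsupp.single_eq_same]
  have hmon (a : (i : Fin n) → Fin (tau p χ d i + 1)) {m : ℕ} (hm : ∑ i, (a i : ℕ) < m) :
      g.monomial e (fun i => a i) ∈ g.filt e d m (∑ i, (a i : ℕ) • d i) := by
    rw [← word_sortedWord]
    refine word_mem_filt ?_ ?_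
    · rw [length_eq_sum_count]; simpa only [count_sortedWord] using hm
    · rw [map_sum_eq_sum_count]; simp only [count_sortedWord]
  -- Modulo words of length less than `N`, the words of length at most `N` and degree `δ` span at
  -- most the line of `top`, with coordinate `φ`.
  have hsub {z : g.RestrictedEnveloping} (hz : z ∈ g.filt e d (N + 1) δ) :
      z - φ z • top ∈ g.filt e d N δ := by
    replace hz := filt_le_span_monomial he hp h2 _ _ hz
    induction hz using Submodule.span_induction with
    | mem z hz =>
      obtain ⟨a, ha, hdeg, rfl⟩ := hz
      by_cases hat : a = fun _ => Fin.last _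
      · rw [← hB, hat, ← htop, hφtop, one_smul, sub_self]; exact zero_mem _
      · have hlt := sum_val_lt_of_ne_last hat
        rw [← hB, hφ, Module.Basis.coord_apply, Module.Basis.repr_self,
          Finsupp.single_eq_of_ne (Ne.symm hat), zero_smul, sub_zero, hB, ← hdeg]
        exact hmon a hlt
    | zero => simp
    | add x y _ _ hx hy =>
      have := add_mem hx hy
      rwa [sub_add_sub_comm, ← add_smul, ← map_add] at this
    | smul r x _ hx =>
      have := Submodule.smul_mem _ r hx
      rwa [smul_sub, smul_smul, ← smul_eq_mul, ← map_smul φ] at this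
  set T := LinearMap.mulLeft F (g.uι (e i)) - LinearMap.mulRight F (g.uι (e i)) with hT
  have hTm {m : ℕ} {β : Γ} {z : g.RestrictedEnveloping} (hz : z ∈ g.filt e d m β) :
      T z ∈ g.filt e d m β := by
    induction hz using Submodule.span_induction with
    | mem z hz =>
      obtain ⟨w, hw, rfl, rfl⟩ := hz
      have h := uι_mul_word_sub_mem_filt he i w
      rw [hi, χ.toFun_zero_left, Units.val_one, one_smul, zero_add] at h
      exact filt_mono hw _ h
    | zero => rw [map_zero]; exact zero_mem _
    | add x y _ _ hx hy => rw [map_add]; exact add_mem hx hy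
    | smul r x _ hx => rw [map_smul]; exact Submodule.smul_mem _ r hx
  have htopm : top ∈ g.filt e d (N + 1) δ := by
    have h := hmon (fun _ => Fin.last _) (m := N + 1) (by simp [hN])
    rw [← hB] at h
    simpa only [Fin.val_last] using h
  -- As `e i` has degree 0, `T` preserves length and degree bounds, so it acts on that line by the
  -- scalar `φ (T top)`. Nilpotency of `T` then forces the scalar to be zero.
  have hiter (k : ℕ) : (T ^ k) top - φ (T top) ^ k • top ∈ g.filt e d N δ := by
    induction k with
    | zero => simp
    | succ k ih =>
      have h1 := hTm ih
      have h2 := Submodule.smul_mem _ (φ (T top) ^ k) (hsub (hTm htopm))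
      have h3 := add_mem h1 h2
      rwa [map_sub, map_smul, smul_sub, smul_smul, ← pow_succ, sub_add_sub_cancel,
        ← Module.End.mul_apply, ← pow_succ'] at h3
  obtain ⟨k, -, hk⟩ := hg (d i) (e i) (hi ▸ Bicharacter.even_zero) (he i)
  have hx := g.uι_pow_pow (hi ▸ Bicharacter.even_zero) (he i) k
  rw [hk, map_zero] at hx
  -- Left and right multiplication commute, so in characteristic `p` this power is the difference of
  -- their `p^k`-th powers, both zero because `e i` becomes nilpotent in `u(g)`.
  have hTk : T ^ p ^ k = 0 := by
    rw [hT, Commute.sub_pow_prime_pow_of_cast_eq_zero hpp, LinearMap.pow_mulLeft,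
      LinearMap.pow_mulRight, hx]
    · ext; simp
    · rw [← map_natCast (algebraMap F (Module.End F g.RestrictedEnveloping)), hpF, map_zero]
    · exact LinearMap.commute_mulLeft_right (R := F) _ _
  have h := coord_last_eq_zero_of_mem_filt he hp h2 hB (hiter (p ^ k)) (Or.inl le_rfl)
  rw [hTk, LinearMap.zero_apply, zero_sub, ← hφ, map_neg, map_smul, hφtop, smul_eq_mul, mul_one,
    neg_eq_zero] at h
  have h' := eq_zero_of_pow_eq_zero h
  rw [hT, LinearMap.sub_apply, map_sub, sub_eq_zero] at h'
  exact h'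

/-- For a monomial other than `e^τ` the color commutator with `e_i` is too short to reach the top.
For `e^τ` its degree is shifted by `d i`, so it has no top coefficient unless `d i = 0`, the case
settled by nilpotency. -/
theorem coord_last_uι_mul (hpp : p.Prime) (hpF : (p : F) = 0) (hg : g.IsUnipotent) (i : Fin n)
    {β : Γ} {z : g.RestrictedEnveloping} (hz : z ∈ g.uGrading β) :
    B.coord (fun _ => Fin.last _) (g.uι (e i) * z) =
      (χ.toFun (d i) β : F) * B.coord (fun _ => Fin.last _) (z * g.uι (e i)) := by
  replace hz := uGrading_le_span_monomial he hp h2 β hz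
  induction hz using Submodule.span_induction with
  | mem z hz =>
    obtain ⟨a, hdeg, rfl⟩ := hz
    have hword := uι_mul_word_sub_mem_filt he i (sortedWord fun i => (a i : ℕ))
    rw [map_sum_eq_sum_count, length_eq_sum_count, word_sortedWord] at hword
    simp only [count_sortedWord] at hword
    rw [hdeg] at hword
    rw [← sub_eq_zero, ← smul_eq_mul (χ.toFun (d i) β : F), ← map_smul, ← map_sub]
    by_cases hat : a = fun _ => Fin.last _
    · subst hat
      simp only [Fin.val_last] at hdeg
      by_cases hi : d i = 0
      · rw [hi, χ.toFun_zero_left, Units.val_one, one_smul, map_sub, sub_eq_zero, ← hB]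
        exact coord_last_commutator_eq_zero he hp h2 hB hpp hpF hg hi
      · refine coord_last_eq_zero_of_mem_filt he hp h2 hB hword (Or.inr fun h => hi ?_)
        rw [hdeg] at h
        exact right_eq_add.1 h
    · exact coord_last_eq_zero_of_mem_filt he hp h2 hB hword (Or.inl (sum_val_lt_of_ne_last hat))
  | zero => simp
  | add x y _ _ hx hy => rw [mul_add, add_mul, map_add, map_add, hx, hy, mul_add]
  | smul r x _ hx =>
    rw [mul_smul_comm, smul_mul_assoc, map_smul, map_smul, hx, smul_eq_mul, smul_eq_mul,
      mul_left_comm]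

theorem isColorSymmetric_mulForm_coord_last (hpp : p.Prime) (hpF : (p : F) = 0)
    (hg : g.IsUnipotent) :
    IsColorSymmetric χ g.uGrading (mulForm (B.coord fun _ => Fin.last _)) := by
  intro α β x y hx hy
  change B.coord _ (x * y) = (χ.toFun α β : F) * B.coord _ (y * x)
  have hwgr (w : List (Fin n)) : g.word e w ∈ g.uGrading (w.map d).sum := by
    refine Submodule.subset_span ⟨w.map fun i => (d i, e i), ?_, ?_, ?_⟩
    · intro q hq
      obtain ⟨i, -, rfl⟩ := List.mem_map.1 hq
      exact he i
    · simp [Function.comp_def]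
    · simp [word, Function.comp_def]
  have hw (w : List (Fin n)) (β : Γ) (y) (hy : y ∈ g.uGrading β) :
      B.coord (fun _ => Fin.last _) (g.word e w * y) =
        (χ.toFun (w.map d).sum β : F) * B.coord (fun _ => Fin.last _) (y * g.word e w) := by
    induction w generalizing β y with
    | nil => simp [χ.toFun_zero_left]
    | cons i w ih =>
      have hi : g.uι (e i) ∈ g.uGrading (d i) := g.uι_mem (he i)
      rw [word_cons, mul_assoc, coord_last_uι_mul he hp h2 hB hpp hpF hg i
        (SetLike.mul_mem_graded (hwgr w) hy), mul_assoc, ih _ _ (SetLike.mul_mem_graded hy hi),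
        ← mul_assoc, ← mul_assoc, χ.add_right, χ.add_right, List.map_cons, List.sum_cons, χ.add_left,
        Units.val_mul, Units.val_mul, Units.val_mul]
      congr 1
      -- Moving `e_i` around past `w y`, then `w` past `y e_i`, produces the extra factors `(d i,
      -- |w|)` and `(|w|, d i)`, with `|w|` the degree of `w`, and these cancel.
      have h := χ.val_mul_swap (d i) (w.map d).sum
      linear_combination (χ.toFun (d i) β : F) * (χ.toFun (w.map d).sum β : F) * h
  obtain ⟨m, hm⟩ := exists_mem_filt he hx
  clear hx
  induction hm using Submodule.span_induction with
  | mem z hz =>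
    obtain ⟨w, -, rfl, rfl⟩ := hz
    exact hw w β y hy
  | zero => simp
  | add u v _ _ hu hv => rw [mul_add, add_mul, map_add, map_add, hu, hv, mul_add]
  | smul r u _ hu =>
    rw [mul_smul_comm, smul_mul_assoc, map_smul, map_smul, hu, smul_eq_mul, smul_eq_mul,
      mul_left_comm]

end FrobeniusForm

end RestrictedLieColorAlgebra

/-! ### Conclusion -/

theorem lemma2p19 {F : Type*} [Field F] [IsAlgClosed F] (p : ℕ) [CharP F p] (hp : 3 < p)
    {Γ : Type*} [AddCommGroup Γ] [DecidableEq Γ] (χ : Bicharacter F Γ)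
    {L : Type*} [AddCommGroup L] [Module F L] [FiniteDimensional F L]
    (g : RestrictedLieColorAlgebra p χ L) (hg : g.IsUnipotent) :
    IsColorSymmetricAlgebra χ g.uGrading ∧
    ∀ (n : ℕ) (e : Module.Basis (Fin n) F L) (d : Fin n → Γ),
      (∀ i, e i ∈ g.comp (d i)) →
      (∀ i j, χ.Even (d i) → ¬ χ.Even (d j) → i < j) →
      ∃ B : Module.Basis
          ((i : Fin n) → Fin (RestrictedLieColorAlgebra.tau p χ d i + 1)) F
          g.RestrictedEnveloping,
        (∀ a, B a = g.monomial e (fun i => (a i : ℕ))) ∧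
        IsFrobeniusForm (mulForm (B.coord fun i => Fin.last _)) ∧
        IsColorSymmetric χ g.uGrading (mulForm (B.coord fun i => Fin.last _)) := by
  have hpp : p.Prime := (CharP.char_is_prime_or_zero F p).resolve_right (by omega)
  have hodd : Odd p := hpp.odd_of_ne_two (by omega)
  have hF : ∀ i : ℕ, (i : F) = 0 ↔ p ∣ i := CharP.cast_eq_zero_iff F p
  have hpF : (p : F) = 0 := (hF p).2 dvd_rfl
  have h2 : (2 : F) ≠ 0 := fun h =>
    absurd (Nat.le_of_dvd two_pos ((hF 2).1 (by exact_mod_cast h))) (by omega)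
  have h3 : (3 : F) ≠ 0 := fun h =>
    absurd (Nat.le_of_dvd three_pos ((hF 3).1 (by exact_mod_cast h))) (by omega)
  have main : ∀ (n : ℕ) (e : Module.Basis (Fin n) F L) (d : Fin n → Γ),
      (∀ i, e i ∈ g.comp (d i)) →
      ∃ B : Module.Basis
          ((i : Fin n) → Fin (RestrictedLieColorAlgebra.tau p χ d i + 1)) F
          g.RestrictedEnveloping,
        (∀ a, B a = g.monomial e (fun i => (a i : ℕ))) ∧
        IsFrobeniusForm (mulForm (B.coord fun i => Fin.last _)) ∧
        IsColorSymmetric χ g.uGrading (mulForm (B.coord fun i => Fin.last _)) := by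
    intro n e d he
    obtain ⟨B, hB⟩ := RestrictedLieColorAlgebra.exists_monomial_basis hpp hodd hF h2 h3 hg he
    exact ⟨B, hB,
      RestrictedLieColorAlgebra.isFrobeniusForm_mulForm_coord_last he hpp.one_lt h2 hB,
      RestrictedLieColorAlgebra.isColorSymmetric_mulForm_coord_last he hpp.one_lt h2 hB hpp hpF hg⟩
  refine ⟨?_, fun n e d he _ => main n e d he⟩
  obtain ⟨n, e, d, he, -⟩ :=
    RestrictedLieColorAlgebra.exists_homogeneous_basis_prod_le_finrank hpp hodd hF h2 h3 g hg
  obtain ⟨B, -, hfrob, hsymm⟩ := main n e d he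
  exact ⟨_, hfrob, hsymm⟩
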